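/- **Conventions.** Let $R$ be a commutative ring and $r\ge 0$. A power series $f=\sum_{n\ge0}f_ns^n\in R[y_1,\dots,y_r][[s]]$ is called *regular* if $f_n$ has total degree at most $n$ in $y_1,\dots,y_r$ for every $n\ge 0$; these series form a subring $R[y_1,\dots,y_r]^{reg}[[s]]$, and $R[y_1,\dots,y_r]^{reg}[[s]]/\langle s^d\rangle$ denotes its image in $R[y_1,\dots,y_r][[s]]/\langle s^d\rangle$. Its elements are represented by their coefficients in $R$ at the monomials $s^i y^a$ with $0\le i<d$ and $|a|\le i$. An element $\omega\in R$ is a primitive $n$-th root of unity if $\omega^n=1$, $n$ is invertible in $R$, and $\omega^{n/t}-1$ is not a zero divisor for every prime divisor $t$ of $n$. The ring $R$ supports the fast Fourier transform (FFT) if it has a primitive $2^k$-th root of unity $\omega_k$ for every integer $k\ge 0$. A ring operation is an addition, a subtraction, a multiplication, or the inversion of a unit of $R$. Algorithms are straight-line programs of ring operations whose operands are the inputs, the constants $0$ and $1$, the roots of unity $\omega_k$, and earlier results. **Theorem.** There is an absolute constant $C$ such that the following holds for all integers $r\ge 0$ and $\ell\ge 1$, with $d=2^\ell$. There are four straight-line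 programs, depending only on $r$ and $\ell$, each with at most $C\,d^{r+1}\log(d^{r+1})$ ring operations, such that for every commutative ring $R$ that contains $\mathbb{Q}$, or contains $\mathbb{Z}_p=\mathbb{Z}/p\mathbb{Z}$ for some prime $p>d$, and that supports the FFT, and for every choice of primitive $2^k$-th roots of unity $\omega_k\in R$ $(k\ge 0)$, they compute respectively the following operations on $f,g\in R[y_1,\dots,y_r]^{reg}[[s]]/\langle s^d\rangle$, whose results lie in $R[y_1,\dots,y_r]^{reg}[[s]]/\langle s^d\rangle$ again: 1. multiplication: $(f,g)\mapsto fg$; 2. division: $(f,g)\mapsto g/f$, i.e. the element $h$ with $hf=g$, whenever the constant coefficient $f_0$ is invertible; 3. exponential: $f\mapsto e^{f}=\sum_{n=0}^{d-1}\frac{1}{n!}f^n$, whenever $f_0=0$; 4. logarithm: $f\mapsto \ln f=\sum_{n=1}^{d-1}\frac{(-1)^{n+1}}{n}(f-1)^n$, whenever $f_0=1$. -/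

import Mathlib

universe u

/-! ### Rings supporting the fast Fourier transform -/

/-- `ω` is a primitive `n`-th root of unity in the commutative ring `R`, in the sense used for the
fast Fourier transform over rings that may have zero divisors: `ω ^ n = 1`, the integer `n` is
invertible in `R`, and `ω ^ (n / t) - 1` is not a zero divisor for any prime divisor `t` of `n`. -/
structure IsFFTRoot {R : Type*} [CommRing R] (ω : R) (n : ℕ) : Prop where
  pow_eq_one : ω ^ n = 1
  isUnit_natCast : IsUnit (n : R)
  sub_one_mem : ∀ t : ℕ, t.Prime → t ∣ n → ω ^ (n / t) - 1 ∈ nonZeroDivisors R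

/-- The sequence `ω` exhibits that `R` supports the FFT: `ω k` is a primitive `2 ^ k`-th root of
unity for every natural number `k`. (`R` supports the FFT iff there is such a sequence.) -/
def SupportsFFTVia {R : Type*} [CommRing R] (ω : ℕ → R) : Prop :=
  ∀ k : ℕ, IsFFTRoot (ω k) (2 ^ k)

/-- `R` contains the field `ℚ`, or the field `ℤ / p` for some prime `p > d`. -/
def ContainsRatOrZMod (R : Type*) [CommRing R] (d : ℕ) : Prop :=
  (∃ φ : ℚ →+* R, Function.Injective φ) ∨
    ∃ p : ℕ, p.Prime ∧ d < p ∧ ∃ φ : ZMod p →+* R, Function.Injective φ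

/-! ### Regular power series modulo `s ^ d` -/

/-- `R[y₁, …, y_r][[s]]`. -/
abbrev YSeries (R : Type*) [CommRing R] (r : ℕ) : Type _ :=
  PowerSeries (MvPolynomial (Fin r) R)

/-- `R[y₁, …, y_r]^reg[[s]]`: the power series in `s` whose `n`-th coefficient has total degree at
most `n` in the variables `y`, for all `n`. -/
noncomputable def regularSeries (R : Type*) [CommRing R] (r : ℕ) : Subring (YSeries R r) where
  carrier := {f | ∀ n : ℕ, (PowerSeries.coeff n f).totalDegree ≤ n}
  zero_mem' := fun n => by simp
  one_mem' := fun n => by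
    rw [PowerSeries.coeff_one]
    split_ifs <;> simp
  add_mem' := fun {f g} hf hg n => by
    rw [map_add]
    exact (MvPolynomial.totalDegree_add _ _).trans (max_le (hf n) (hg n))
  neg_mem' := fun {f} hf n => by
    rw [map_neg, MvPolynomial.totalDegree_neg]
    exact hf n
  mul_mem' := fun {f g} hf hg n => by
    rw [PowerSeries.coeff_mul]
    refine MvPolynomial.totalDegree_finsetSum_le fun p hp => ?_
    rw [← Finset.HasAntidiagonal.mem_antidiagonal.mp hp]
    exact (MvPolynomial.totalDegree_mul _ _).trans (add_le_add (hf _) (hg _))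

/-- `R[y₁, …, y_r][[s]] / ⟨s ^ d⟩`. -/
abbrev YTrunc (R : Type*) [CommRing R] (r d : ℕ) : Type _ :=
  YSeries R r ⧸ Ideal.span {(PowerSeries.X : YSeries R r) ^ d}

/-- `R[y₁, …, y_r]^reg[[s]] / ⟨s ^ d⟩`: the classes modulo `s ^ d` of the regular series. -/
noncomputable def regularTrunc (R : Type*) [CommRing R] (r d : ℕ) : Subring (YTrunc R r d) :=
  (regularSeries R r).map (Ideal.Quotient.mk _)

/-- The coefficient of `s ^ i`, for `i < d`, of a class modulo `s ^ d`. -/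
noncomputable def sCoeff {R : Type*} [CommRing R] {r d : ℕ} (i : Fin d) :
    YTrunc R r d →+ MvPolynomial (Fin r) R :=
  QuotientAddGroup.lift _ (PowerSeries.coeff (R := MvPolynomial (Fin r) R) i).toAddMonoidHom
    (fun f hf => by
      have h : (PowerSeries.X : YSeries R r) ^ d ∣ f := Ideal.mem_span_singleton.mp hf
      exact PowerSeries.X_pow_dvd_iff.mp h i i.isLt)

/-- The monomials `s ^ i * y ^ a` with `i < d` and `|a| ≤ i`: those that can occur in a regular
series modulo `s ^ d`. -/
abbrev RegMonomial (r d : ℕ) : Type :=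
  {m : Fin d × (Fin r →₀ ℕ) // m.2.degree ≤ (m.1 : ℕ)}

/-- The dense representation of a regular series modulo `s ^ d` by its coefficients in `R`. -/
noncomputable def regCoeffs {R : Type*} [CommRing R] {r d : ℕ} (F : YTrunc R r d) (m : RegMonomial r d) : R :=
  (sCoeff m.1.1 F).coeff m.1.2

/-- The exponential modulo `s ^ d` of a class `F` without constant term (so that `F ^ d = 0`).
It is used where `1, …, d - 1` are invertible. -/
noncomputable def truncExp {R : Type*} [CommRing R] {r d : ℕ} (F : YTrunc R r d) :
    YTrunc R r d :=
  ∑ n ∈ Finset.range d, Ring.inverse (n.factorial : YTrunc R r d) * F ^ n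

/-- The logarithm modulo `s ^ d` of a class `F` with constant term `1` (so that `(F - 1) ^ d = 0`).
It is used where `1, …, d - 1` are invertible. -/
noncomputable def truncLog {R : Type*} [CommRing R] {r d : ℕ} (F : YTrunc R r d) :
    YTrunc R r d :=
  ∑ n ∈ Finset.Ico 1 d, (-1) ^ (n + 1) * Ring.inverse (n : YTrunc R r d) * (F - 1) ^ n

/-! ### Straight-line programs over a ring -/

/-- An operand of an instruction: an input, the constant `0` or `1`, the available primitive
`2 ^ k`-th root of unity, or the result of the `j`-th instruction (counted from `0`). -/
inductive Operand (ι : Type) : Type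
  | input (i : ι)
  | zero
  | one
  | root (k : ℕ)
  | reg (j : ℕ)

/-- One ring operation. -/
inductive Instr (ι : Type) : Type
  | add (a b : Operand ι)
  | sub (a b : Operand ι)
  | mul (a b : Operand ι)
  | inv (a : Operand ι)

/-- A straight-line program with inputs indexed by `ι` and outputs indexed by `o`. It refers to
no particular ring. -/
structure RingProgram (ι o : Type) : Type where
  code : List (Instr ι)
  out : o → Operand ι

/-- The value of an operand, given the roots of unity `ω`, the inputs `x` and the results `m` of
the instructions executed so far. A result that is not there yet has no value. -/
def Operand.eval {ι : Type} {R : Type*} [CommRing R] (ω : ℕ → R) (x : ι → R) (m : List R) :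
    Operand ι → Option R
  | .input i => some (x i)
  | .zero => some 0
  | .one => some 1
  | .root k => some (ω k)
  | .reg j => m[j]?

open Classical in
/-- The result of an instruction; the inverse of an element that is not a unit has no value. -/
noncomputable def Instr.eval {ι : Type} {R : Type*} [CommRing R] (ω : ℕ → R) (x : ι → R)
    (m : List R) : Instr ι → Option R
  | .add a b => (a.eval ω x m).bind fun u => (b.eval ω x m).map fun v => u + v
  | .sub a b => (a.eval ω x m).bind fun u => (b.eval ω x m).map fun v => u - v
  | .mul a b => (a.eval ω x m).bind fun u => (b.eval ω x m).map fun v => u * v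
  | .inv a => (a.eval ω x m).bind fun u => if IsUnit u then some (Ring.inverse u) else none

/-- Executes a list of instructions, appending each result to the list `m` of earlier results; the
execution fails as soon as one instruction has no value. -/
noncomputable def execInstrs {ι : Type} {R : Type*} [CommRing R] (ω : ℕ → R) (x : ι → R) :
    List (Instr ι) → List R → Option (List R)
  | [], m => some m
  | c :: cs, m => (c.eval ω x m).bind fun v => execInstrs ω x cs (m ++ [v])

namespace RingProgram

/-- The number of ring operations that the program executes. -/
def cost {ι o : Type} (P : RingProgram ι o) : ℕ := P.code.length

/-- The outputs of the program (`none` if the execution fails). -/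
noncomputable def run {ι o : Type} {R : Type*} [CommRing R] (P : RingProgram ι o) (ω : ℕ → R)
    (x : ι → R) (j : o) : Option R :=
  (execInstrs ω x P.code []).bind fun m => (P.out j).eval ω x m

/-- On the inputs `x` the program executes without failure and its outputs are `z`. -/
def Outputs {ι o : Type} {R : Type*} [CommRing R] (P : RingProgram ι o) (ω : ℕ → R)
    (x : ι → R) (z : o → R) : Prop :=
  (execInstrs ω x P.code []).isSome ∧ ∀ j : o, P.run ω x j = some (z j)

end RingProgram

/-! Let d = 2^ℓ. In a regular series modulo s^d every coefficient has degree below d in each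
variable. The Kronecker substitution y_t ↦ ζ^(j d^t), with ζ a root of unity of order d^r, therefore
turns evaluation at d^r points into one FFT of length d^r for each power of s, and the inverse FFT
recovers the coefficients (`dft_kroneckerVector`). Evaluation is a ring homomorphism, so each
operation splits into d^r independent operations on truncated series in one variable
(`reach_regular`). FFT multiplication and Newton iteration perform these in O(d log d) steps
(`reach_series_mul`, `reach_series_div`, `reach_series_exp`, `reach_series_log`). Altogether this is
O(d^(r+1) log d^(r+1)).

Zero divisors do no harm: of the roots of unity only the equations ω^(2^k) = 1 and ω^(2^(k-1)) = -1
are used, together with the invertibility of 2. Exponential and logarithm enter the univariate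
algorithms through their constant terms and differential equations modulo X^(d-1), which determine
them modulo X^d because 1, …, d-1 are invertible.

The programs must not depend on the ring or on the input. All admissible rings and inputs are
therefore collected in one product ring. A computation there, expressed by `Reach`, acts
componentwise and is a single program that is correct on every instance (`exists_program`). -/

/-! ### Straight-line computations over a single ring -/

/-- From the elements of `K`, all elements of `T` can be computed with at most `c` ring
operations. -/
inductive Reach {A : Type*} [CommRing A] : Set A → ℕ → Set A → Prop
  | done {K : Set A} {c : ℕ} {T : Set A} (h : T ⊆ K) : Reach K c T
  | add {K : Set A} {c : ℕ} {T : Set A} {a b : A} (ha : a ∈ K) (hb : b ∈ K)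
      (h : Reach (insert (a + b) K) c T) : Reach K (c + 1) T
  | sub {K : Set A} {c : ℕ} {T : Set A} {a b : A} (ha : a ∈ K) (hb : b ∈ K)
      (h : Reach (insert (a - b) K) c T) : Reach K (c + 1) T
  | mul {K : Set A} {c : ℕ} {T : Set A} {a b : A} (ha : a ∈ K) (hb : b ∈ K)
      (h : Reach (insert (a * b) K) c T) : Reach K (c + 1) T
  | inv {K : Set A} {c : ℕ} {T : Set A} {a : A} (ha : a ∈ K) (hu : IsUnit a)
      (h : Reach (insert (Ring.inverse a) K) c T) : Reach K (c + 1) T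

/-- The first `n` entries of the sequence `v`. -/
def vals {A : Type*} (v : ℕ → A) (n : ℕ) : Set A := v '' Set.Iio n

theorem vals_subset {A : Type*} {v : ℕ → A} {n : ℕ} {K : Set A} :
    vals v n ⊆ K ↔ ∀ i < n, v i ∈ K := by
  simp [vals, Set.subset_def]

namespace Reach

variable {A : Type*} [CommRing A] {K K' T T' : Set A} {c c' : ℕ}

theorem mono_left (h : Reach K c T) : ∀ {K' : Set A}, K ⊆ K' → Reach K' c T := by
  induction h with
  | done h => exact fun hK => .done (h.trans hK)
  | add ha hb _ ih => exact fun hK => .add (hK ha) (hK hb) (ih (Set.insert_subset_insert hK))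
  | sub ha hb _ ih => exact fun hK => .sub (hK ha) (hK hb) (ih (Set.insert_subset_insert hK))
  | mul ha hb _ ih => exact fun hK => .mul (hK ha) (hK hb) (ih (Set.insert_subset_insert hK))
  | inv ha hu _ ih => exact fun hK => .inv (hK ha) hu (ih (Set.insert_subset_insert hK))

theorem mono_cost (h : Reach K c T) : ∀ {c' : ℕ}, c ≤ c' → Reach K c' T := by
  induction h with
  | done h => exact fun _ => .done h
  | add ha hb _ ih =>
    intro c' hc
    obtain ⟨e, rfl⟩ := Nat.exists_eq_add_of_le' (Nat.one_le_of_lt (Nat.lt_of_succ_le hc))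
    exact .add ha hb (ih (by omega))
  | sub ha hb _ ih =>
    intro c' hc
    obtain ⟨e, rfl⟩ := Nat.exists_eq_add_of_le' (Nat.one_le_of_lt (Nat.lt_of_succ_le hc))
    exact .sub ha hb (ih (by omega))
  | mul ha hb _ ih =>
    intro c' hc
    obtain ⟨e, rfl⟩ := Nat.exists_eq_add_of_le' (Nat.one_le_of_lt (Nat.lt_of_succ_le hc))
    exact .mul ha hb (ih (by omega))
  | inv ha hu _ ih =>
    intro c' hc
    obtain ⟨e, rfl⟩ := Nat.exists_eq_add_of_le' (Nat.one_le_of_lt (Nat.lt_of_succ_le hc))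
    exact .inv ha hu (ih (by omega))

/-- Sequential composition. -/
theorem bind (h : Reach K c T)
    (h' : ∀ K' : Set A, K ⊆ K' → T ⊆ K' → Reach K' c' T') : Reach K (c + c') T' := by
  induction h with
  | done h => exact (h' _ subset_rfl h).mono_cost (Nat.le_add_left _ _)
  | add ha hb _ ih =>
    rw [Nat.add_right_comm]
    exact .add ha hb (ih fun K' hK hT => h' K' ((Set.subset_insert _ _).trans hK) hT)
  | sub ha hb _ ih =>
    rw [Nat.add_right_comm]
    exact .sub ha hb (ih fun K' hK hT => h' K' ((Set.subset_insert _ _).trans hK) hT)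
  | mul ha hb _ ih =>
    rw [Nat.add_right_comm]
    exact .mul ha hb (ih fun K' hK hT => h' K' ((Set.subset_insert _ _).trans hK) hT)
  | inv ha hu _ ih =>
    rw [Nat.add_right_comm]
    exact .inv ha hu (ih fun K' hK hT => h' K' ((Set.subset_insert _ _).trans hK) hT)

theorem add_one {a b : A} (ha : a ∈ K) (hb : b ∈ K) : Reach K 1 {a + b} :=
  .add ha hb (.done (by simp))

theorem sub_one {a b : A} (ha : a ∈ K) (hb : b ∈ K) : Reach K 1 {a - b} :=
  .sub ha hb (.done (by simp))

theorem mul_one {a b : A} (ha : a ∈ K) (hb : b ∈ K) : Reach K 1 {a * b} :=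
  .mul ha hb (.done (by simp))

theorem inv_one {a : A} (ha : a ∈ K) (hu : IsUnit a) : Reach K 1 {Ring.inverse a} :=
  .inv ha hu (.done (by simp))

/-- Several computations, one after the other. -/
theorem iUnion_lt {T : ℕ → Set A} (n : ℕ) (h : ∀ i < n, Reach K c (T i)) :
    Reach K (n * c) (⋃ i < n, T i) := by
  induction n with
  | zero => exact .done (by simp)
  | succ n ih =>
    rw [Nat.succ_mul]
    refine (ih fun i hi => h i (hi.trans n.lt_succ_self)).bind fun K₁ h₁ h₁' => ?_
    refine (((h n n.lt_succ_self).mono_left h₁).bind (c' := 0) fun K₂ h₂ h₂' =>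
      .done (Set.iUnion₂_subset fun i hi => ?_))
    rcases Nat.lt_succ_iff_lt_or_eq.mp hi with hi | rfl
    · exact ((Set.subset_iUnion₂ (s := fun i (_ : i < n) => T i) i hi).trans h₁').trans h₂
    · exact h₂'

/-- The entries of a vector, one after the other. -/
theorem vals_lt {v : ℕ → A} (n : ℕ) (h : ∀ i < n, Reach K c {v i}) :
    Reach K (n * c) (vals v n) := by
  refine (iUnion_lt n h).bind (c' := 0) fun K' _ h' => .done (vals_subset.mpr fun i hi => ?_)
  exact h' (Set.mem_iUnion₂.mpr ⟨i, hi, rfl⟩)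

/-- Computing a sequence by a recursion in which each step costs at most `c` operations. -/
theorem vals_rec {v : ℕ → A} (h0 : v 0 ∈ K)
    (hs : ∀ i (K' : Set A), K ⊆ K' → v i ∈ K' → Reach K' c {v (i + 1)}) (n : ℕ) :
    Reach K (n * c) (vals v (n + 1)) := by
  induction n with
  | zero => exact .done (vals_subset.mpr fun i hi => by simpa [Nat.lt_one_iff.mp hi] using h0)
  | succ n ih =>
    rw [Nat.succ_mul]
    refine ih.bind fun K₁ h₁ h₁' => ?_
    rw [vals_subset] at h₁'
    refine (hs n K₁ h₁ (h₁' n n.lt_succ_self)).bind (c' := 0) fun K₂ h₂ h₂' =>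
      .done (vals_subset.mpr fun i hi => ?_)
    rcases Nat.lt_succ_iff_lt_or_eq.mp hi with hi | rfl
    · exact h₂ (h₁' i hi)
    · exact h₂' rfl

theorem pow_vals {w : A} (h1 : 1 ∈ K) (hw : w ∈ K) (n : ℕ) :
    Reach K n (vals (fun i => w ^ i) (n + 1)) := by
  have := vals_rec (K := K) (c := 1) (v := fun i => w ^ i) (by simpa using h1)
    (fun i K' hK hi => by simpa only [pow_succ] using mul_one hi (hK hw)) n
  rwa [Nat.mul_one] at this

theorem natCast_vals (h0 : (0 : A) ∈ K) (h1 : (1 : A) ∈ K) (n : ℕ) :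
    Reach K n (vals (fun i => (i : A)) (n + 1)) := by
  have := vals_rec (K := K) (c := 1) (v := fun i => (i : A)) (by simpa using h0)
    (fun i K' hK hi => by simpa only [Nat.cast_succ] using add_one hi (hK h1)) n
  rwa [Nat.mul_one] at this

end Reach

/-! ### From computations in a product ring to uniform programs -/

section Program

variable {ι o : Type} {R : Type*} [CommRing R] {ω : ℕ → R} {x : ι → R}

theorem execInstrs_append (cs cs' : List (Instr ι)) (m : List R) :
    execInstrs ω x (cs ++ cs') m = (execInstrs ω x cs m).bind (execInstrs ω x cs') := by
  induction cs generalizing m with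
  | nil => rfl
  | cons c cs ih =>
    simp only [List.cons_append, execInstrs, Option.bind_assoc]
    congr 1
    funext v
    exact ih _

theorem execInstrs_length {cs : List (Instr ι)} {m m' : List R}
    (h : execInstrs ω x cs m = some m') : m'.length = m.length + cs.length := by
  induction cs generalizing m with
  | nil => simp [execInstrs] at h; simp [h]
  | cons c cs ih =>
    simp only [execInstrs, Option.bind_eq_some_iff] at h
    obtain ⟨v, -, h⟩ := h
    rw [ih h]
    simp
    omega

theorem Operand.eval_append {p : Operand ι} {m : List R} {v : R} (h : p.eval ω x m = some v)
    (m' : List R) : p.eval ω x (m ++ m') = some v := by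
  cases p with
  | reg j =>
    simp only [Operand.eval] at h ⊢
    rw [List.getElem?_append_left (List.getElem?_eq_some_iff.mp h).1]
    exact h
  | _ => exact h

end Program

/-- A ring with roots of unity and inputs subject to the condition `Q`. -/
structure ProgramInstance (ι : Type)
    (Q : ∀ (R : Type u) [CommRing R], (ℕ → R) → (ι → R) → Prop) where
  R : Type u
  [ring : CommRing R]
  ω : ℕ → R
  x : ι → R
  cond : Q R ω x

attribute [instance] ProgramInstance.ring

/-- The product of the rings of all instances. -/
abbrev UniversalRing (ι : Type) (Q : ∀ (R : Type u) [CommRing R], (ℕ → R) → (ι → R) → Prop) :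
    Type (u + 1) :=
  ∀ s : ProgramInstance ι Q, s.R

/-- The code `cs` runs without failure on all instances, and computes all elements of `K`. -/
def Provides {ι : Type} {Q : ∀ (R : Type u) [CommRing R], (ℕ → R) → (ι → R) → Prop}
    (cs : List (Instr ι)) (K : Set (UniversalRing ι Q)) : Prop :=
  ∃ m : ∀ s : ProgramInstance ι Q, List s.R,
    (∀ s, execInstrs s.ω s.x cs [] = some (m s)) ∧
    ∀ a ∈ K, ∃ p : Operand ι, ∀ s, p.eval s.ω s.x (m s) = some (a s)

theorem isUnit_apply {I : Type*} {S : I → Type*} [∀ i, CommRing (S i)] {a : ∀ i, S i}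
    (h : IsUnit a) (i : I) : IsUnit (a i) := h.map (Pi.evalRingHom S i)

theorem map_ring_inverse {A B F : Type*} [CommRing A] [CommRing B] [FunLike F A B]
    [RingHomClass F A B] (φ : F) {a : A} (h : IsUnit a) :
    φ (Ring.inverse a) = Ring.inverse (φ a) := by
  obtain ⟨u, rfl⟩ := h
  rw [Ring.inverse_unit]
  exact (Ring.inverse_unit (Units.map (φ : A →* B) u)).symm

section Extract

variable {ι : Type} {Q : ∀ (R : Type u) [CommRing R], (ℕ → R) → (ι → R) → Prop}
  {cs : List (Instr ι)} {K T : Set (UniversalRing ι Q)}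

/-- The new result has index `cs.length` on every instance, so one operand names it uniformly. -/
theorem Provides.insert {i : Instr ι} {a : UniversalRing ι Q} {m : ∀ s : ProgramInstance ι Q, List s.R}
    (hm : ∀ s, execInstrs s.ω s.x cs [] = some (m s))
    (hK : ∀ a ∈ K, ∃ p : Operand ι, ∀ s, p.eval s.ω s.x (m s) = some (a s))
    (hi : ∀ s, i.eval s.ω s.x (m s) = some (a s)) : Provides (cs ++ [i]) (insert a K) := by
  refine ⟨fun s => m s ++ [a s], fun s => ?_, fun b hb => ?_⟩
  · rw [execInstrs_append, hm]
    simp [execInstrs, hi]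
  · rcases hb with rfl | hb
    · refine ⟨.reg cs.length, fun s => ?_⟩
      have := execInstrs_length (hm s)
      simp only [List.length_nil, Nat.zero_add] at this
      simp [Operand.eval, ← this]
    · obtain ⟨p, hp⟩ := hK b hb
      exact ⟨p, fun s => Operand.eval_append (hp s) _⟩

/-- Ring operations in the product are componentwise, so each step becomes one instruction whose
operands are chosen before the instance. -/
theorem Reach.provides {c : ℕ} (h : Reach K c T) :
    ∀ cs : List (Instr ι), Provides cs K →
      ∃ cs' : List (Instr ι), cs'.length ≤ cs.length + c ∧ Provides cs' T := by
  induction h with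
  | done h =>
    rintro cs ⟨m, hm, hK⟩
    exact ⟨cs, Nat.le_add_right _ _, m, hm, fun a ha => hK a (h ha)⟩
  | add ha hb _ ih =>
    rintro cs ⟨m, hm, hK⟩
    obtain ⟨p, hp⟩ := hK _ ha
    obtain ⟨q, hq⟩ := hK _ hb
    obtain ⟨cs', h₁, h₂⟩ := ih _ (Provides.insert (i := .add p q) hm hK
      fun s => by simp [Instr.eval, hp s, hq s])
    exact ⟨cs', by simp at h₁; omega, h₂⟩
  | sub ha hb _ ih =>
    rintro cs ⟨m, hm, hK⟩
    obtain ⟨p, hp⟩ := hK _ ha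
    obtain ⟨q, hq⟩ := hK _ hb
    obtain ⟨cs', h₁, h₂⟩ := ih _ (Provides.insert (i := .sub p q) hm hK
      fun s => by simp [Instr.eval, hp s, hq s])
    exact ⟨cs', by simp at h₁; omega, h₂⟩
  | mul ha hb _ ih =>
    rintro cs ⟨m, hm, hK⟩
    obtain ⟨p, hp⟩ := hK _ ha
    obtain ⟨q, hq⟩ := hK _ hb
    obtain ⟨cs', h₁, h₂⟩ := ih _ (Provides.insert (i := .mul p q) hm hK
      fun s => by simp [Instr.eval, hp s, hq s])
    exact ⟨cs', by simp at h₁; omega, h₂⟩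
  | @inv _ _ _ a ha hu _ ih =>
    rintro cs ⟨m, hm, hK⟩
    obtain ⟨p, hp⟩ := hK _ ha
    obtain ⟨cs', h₁, h₂⟩ := ih _ (Provides.insert (i := .inv p) hm hK
      fun s => by
        -- A unit of the product is a unit in every factor, so the inversion fails on no instance,
        -- and its result is the componentwise inverse.
        have := map_ring_inverse (Pi.evalRingHom (fun s : ProgramInstance ι Q => s.R) s) hu
        simp only [Pi.evalRingHom_apply] at this
        simp [Instr.eval, hp s, isUnit_apply hu s, this])
    exact ⟨cs', by simp at h₁; omega, h₂⟩

end Extract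

/-- The constants and inputs that are available to every program. -/
def initialSet {ι : Type} {A : Type*} [CommRing A] (ω : ℕ → A) (x : ι → A) : Set A :=
  {0, 1} ∪ Set.range ω ∪ Set.range x

/-- A computation in the product of the rings of all instances is a uniform program. -/
theorem exists_program {ι o : Type}
    {Q : ∀ (R : Type u) [CommRing R], (ℕ → R) → (ι → R) → Prop} {c : ℕ}
    (z : o → UniversalRing ι Q)
    (h : Reach (initialSet (fun k (s : ProgramInstance ι Q) => s.ω k) (fun i s => s.x i)) c
      (Set.range z)) :
    ∃ P : RingProgram ι o, P.cost ≤ c ∧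
      ∀ s : ProgramInstance ι Q, P.Outputs s.ω s.x (fun j => z j s) := by
  obtain ⟨cs, hcs, m, hm, hT⟩ := h.provides [] ⟨fun _ => [], fun _ => rfl, by
    rintro a (((rfl | rfl) | ⟨k, rfl⟩) | ⟨i, rfl⟩)
    · exact ⟨.zero, fun _ => rfl⟩
    · exact ⟨.one, fun _ => rfl⟩
    · exact ⟨.root k, fun _ => rfl⟩
    · exact ⟨.input i, fun _ => rfl⟩⟩
  choose p hp using fun j => hT (z j) ⟨j, rfl⟩
  refine ⟨⟨cs, p⟩, by simpa [RingProgram.cost] using hcs, fun s => ⟨?_, fun j => ?_⟩⟩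
  · simp [hm s]
  · simp [RingProgram.run, hm s, hp j s]

/-! ### The discrete Fourier transform -/

section DFT

variable {A : Type*} [CommRing A]

/-- The `j`-th entry of the discrete Fourier transform of size `n` of the vector `a`. -/
def dft (n : ℕ) (w : A) (a : ℕ → A) (j : ℕ) : A :=
  ∑ i ∈ Finset.range n, a i * w ^ (i * j)

theorem sum_range_two_mul {M : Type*} [AddCommMonoid M] (n : ℕ) (f : ℕ → M) :
    ∑ i ∈ Finset.range (2 * n), f i =
      ∑ i ∈ Finset.range n, f (2 * i) + ∑ i ∈ Finset.range n, f (2 * i + 1) := by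
  induction n with
  | zero => simp
  | succ n ih =>
    rw [Nat.mul_succ, Finset.sum_range_succ, Finset.sum_range_succ, ih, Finset.sum_range_succ,
      Finset.sum_range_succ]
    abel

/-- Cooley–Tukey splitting by the parity of the index: both halves are transforms of half the size
for the root w². -/
theorem dft_two_mul (n : ℕ) (w : A) (a : ℕ → A) (j : ℕ) :
    dft (2 * n) w a j = dft n (w * w) (fun i => a (2 * i)) j +
      w ^ j * dft n (w * w) (fun i => a (2 * i + 1)) j := by
  rw [dft, sum_range_two_mul, dft, dft, Finset.mul_sum]
  congr 1
  · exact Finset.sum_congr rfl fun i _ => by ring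
  · exact Finset.sum_congr rfl fun i _ => by ring

/-- Periodicity lets the n entries of each half-size transform serve all 2n entries of the full one.
-/
theorem dft_mod (n : ℕ) {w : A} (hw : w ^ n = 1) (a : ℕ → A) (j : ℕ) :
    dft n w a (j % n) = dft n w a j := by
  refine Finset.sum_congr rfl fun i _ => ?_
  conv_rhs => rw [← Nat.mod_add_div j n]
  rw [Nat.mul_add, pow_add, mul_left_comm i n, pow_mul w n, hw, one_pow, mul_one]

/-- The fast Fourier transform. -/
theorem reach_dft (k : ℕ) : ∀ {K : Set A} {w : A} {a : ℕ → A}, 1 ∈ K → w ∈ K →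
    (∀ i < 2 ^ k, a i ∈ K) → w ^ 2 ^ k = 1 →
      Reach K (4 * k * 2 ^ k) (vals (dft (2 ^ k) w a) (2 ^ k)) := by
  induction k with
  | zero =>
    intro K w a h1 hw ha _
    refine .done (vals_subset.mpr fun i hi => ?_)
    have : i = 0 := by simpa using hi
    simpa [dft, this] using ha 0 (by simp)
  | succ k ih =>
    intro K w a h1 hw ha hroot
    have hroot' : (w * w) ^ 2 ^ k = 1 := by rw [← pow_two, ← pow_mul, ← pow_succ', hroot]
    have hpos : 0 < 2 ^ k := Nat.two_pow_pos k
    -- One operation for w², 2^(k+1) for the powers of w, two half-size transforms, and two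
    -- operations per output entry.
    refine Reach.mono_cost (c := 1 + (2 ^ (k + 1) + (4 * k * 2 ^ k + (4 * k * 2 ^ k +
      2 ^ (k + 1) * (1 + 1))))) ?_ (by rw [pow_succ]; nlinarith)
    refine (Reach.mul_one hw hw).bind fun K₁ s₁ m₁ => ?_
    refine (Reach.pow_vals (s₁ h1) (s₁ hw) (2 ^ (k + 1))).bind fun K₂ s₂ m₂ => ?_
    have t₂ := s₁.trans s₂
    refine (ih (a := fun i => a (2 * i)) (t₂ h1) (s₂ (m₁ rfl))
      (fun i hi => t₂ (ha _ (by rw [pow_succ]; omega))) hroot').bind fun K₃ s₃ m₃ => ?_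
    have t₃ := t₂.trans s₃
    refine (ih (a := fun i => a (2 * i + 1)) (t₃ h1) (s₃ (s₂ (m₁ rfl)))
      (fun i hi => t₃ (ha _ (by rw [pow_succ]; omega))) hroot').bind fun K₄ s₄ m₄ => ?_
    rw [vals_subset] at m₂ m₃ m₄
    refine Reach.vals_lt _ fun j hj => ?_
    refine (Reach.mul_one (s₄ (s₃ (m₂ j (by omega))))
      (m₄ (j % 2 ^ k) (Nat.mod_lt _ hpos))).bind fun K₅ s₅ m₅ => ?_
    have := Reach.add_one (s₅ (s₄ (m₃ (j % 2 ^ k) (Nat.mod_lt _ hpos)))) (m₅ rfl)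
    rwa [dft_mod _ hroot', dft_mod _ hroot', ← dft_two_mul, ← pow_succ'] at this

/-- A sum of powers over a range of length `2 ^ k` as a product. -/
theorem geom_sum_two_pow (u : A) (k : ℕ) :
    ∑ j ∈ Finset.range (2 ^ k), u ^ j = ∏ i ∈ Finset.range k, (1 + u ^ 2 ^ i) := by
  induction k with
  | zero => simp
  | succ k ih =>
    rw [Finset.prod_range_succ, ← ih, pow_succ', two_mul, Finset.sum_range_add, mul_add, mul_one]
    congr 1
    rw [Finset.sum_mul]
    exact Finset.sum_congr rfl fun i _ => by rw [pow_add, mul_comm]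

/-- `w` is a `2 ^ k`-th root of unity whose `2 ^ (k - 1)`-th power is `-1`. -/
structure IsTwoPowRoot (w : A) (k : ℕ) : Prop where
  pow_eq_one : w ^ 2 ^ k = 1
  pow_eq_neg_one : ∀ j, k = j + 1 → w ^ 2 ^ j = -1

namespace IsTwoPowRoot

variable {w : A} {k : ℕ}

theorem isUnit (h : IsTwoPowRoot w k) : IsUnit w :=
  IsUnit.of_pow_eq_one h.pow_eq_one (Nat.two_pow_pos k).ne'

theorem inverse (h : IsTwoPowRoot w k) : IsTwoPowRoot (Ring.inverse w) k := by
  have hw := h.isUnit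
  have key : ∀ n, w ^ n * Ring.inverse w ^ n = 1 := fun n => by
    rw [← mul_pow, Ring.mul_inverse_cancel _ hw, one_pow]
  refine ⟨by simpa [h.pow_eq_one] using key (2 ^ k), fun j hj => ?_⟩
  have := key (2 ^ j)
  rw [h.pow_eq_neg_one j hj] at this
  linear_combination -this

/-- Dividing by w^m - 1 is not allowed in the presence of zero divisors. Instead, `geom_sum_two_pow`
gives a product, and for m = 2^t q with q odd its factor with index k-1-t is 1 + (-1)^q = 0. -/
theorem sum_pow_eq_zero (h : IsTwoPowRoot w k) {m : ℕ} (hm : 0 < m) (hmk : m < 2 ^ k) :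
    ∑ j ∈ Finset.range (2 ^ k), (w ^ m) ^ j = 0 := by
  obtain ⟨t, q, hq, rfl⟩ := Nat.exists_eq_two_pow_mul_odd hm.ne'
  have ht : t < k := by
    refine (Nat.pow_lt_pow_iff_right (a := 2) (by norm_num)).mp (lt_of_le_of_lt ?_ hmk)
    exact Nat.le_mul_of_pos_right _ hq.pos
  rw [geom_sum_two_pow]
  refine Finset.prod_eq_zero (i := k - 1 - t) (Finset.mem_range.mpr (by omega)) ?_
  have : 2 ^ t * q * 2 ^ (k - 1 - t) = 2 ^ (k - 1) * q := by
    rw [mul_right_comm, ← pow_add]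
    congr 2
    omega
  rw [← pow_mul, this, pow_mul, h.pow_eq_neg_one (k - 1) (by omega), hq.neg_one_pow]
  ring

/-- Orthogonality: in the double sum the diagonal contributes 2^k copies of `a i`. Off the diagonal
the sign of i - i' decides whether a power of w⁻¹ or of w is summed, and both sums vanish. -/
theorem dft_inverse_dft (h : IsTwoPowRoot w k) (a : ℕ → A) {i : ℕ} (hi : i < 2 ^ k) :
    dft (2 ^ k) (Ring.inverse w) (dft (2 ^ k) w a) i = ((2 : A) ^ k) * a i := by
  have key : ∀ n, w ^ n * Ring.inverse w ^ n = 1 := fun n => by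
    rw [← mul_pow, Ring.mul_inverse_cancel _ h.isUnit, one_pow]
  simp only [dft, Finset.sum_mul]
  rw [Finset.sum_comm, Finset.sum_eq_single i]
  · rw [Finset.sum_congr rfl (g := fun _ => a i)]
    · simp
    · intro j _
      rw [mul_assoc, mul_comm j i, key, mul_one]
  · intro i' hi' hne
    rw [Finset.mem_range] at hi'
    rcases Nat.lt_or_gt_of_ne hne with hlt | hlt
    · rw [Finset.sum_congr rfl (g := fun j => a i' * (Ring.inverse w ^ (i - i')) ^ j),
        ← Finset.mul_sum, h.inverse.sum_pow_eq_zero (by omega) (by omega), mul_zero]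
      intro j _
      have : j * i = i' * j + (i - i') * j := by rw [← Nat.add_mul, mul_comm]; congr 1; omega
      rw [this, pow_add, mul_assoc, ← mul_assoc (w ^ _), key, one_mul, pow_mul]
    · rw [Finset.sum_congr rfl (g := fun j => a i' * (w ^ (i' - i)) ^ j),
        ← Finset.mul_sum, h.sum_pow_eq_zero (by omega) (by omega), mul_zero]
      intro j _
      have : i' * j = (i' - i) * j + j * i := by rw [mul_comm j i, ← Nat.add_mul]; congr 1; omega
      rw [this, pow_add, mul_assoc, mul_assoc, key, mul_one, pow_mul]
  · intro hi'
    exact absurd (Finset.mem_range.mpr hi) hi'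

end IsTwoPowRoot

/-- The inverse fast Fourier transform. -/
theorem reach_of_dft {K : Set A} {w : A} {k : ℕ} {a : ℕ → A} (h2 : IsUnit (2 : A))
    (h1 : 1 ∈ K) (hw : w ∈ K) (hroot : IsTwoPowRoot w k)
    (ha : ∀ j < 2 ^ k, dft (2 ^ k) w a j ∈ K) :
    Reach K ((4 * k + 5) * 2 ^ k) (vals a (2 ^ k)) := by
  have hk := k.lt_two_pow_self
  refine Reach.mono_cost (c := 1 + (4 * k * 2 ^ k + (1 + (k + (1 + 2 ^ k * 1))))) ?_
    (by nlinarith)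
  refine (Reach.inv_one hw hroot.isUnit).bind fun K₁ s₁ m₁ => ?_
  refine (reach_dft k (s₁ h1) (m₁ rfl) (fun i hi => s₁ (ha i hi))
    hroot.inverse.pow_eq_one).bind fun K₂ s₂ m₂ => ?_
  have t₂ := s₁.trans s₂
  refine (Reach.add_one (t₂ h1) (t₂ h1)).bind fun K₃ s₃ m₃ => ?_
  refine (Reach.pow_vals (s₃ (t₂ h1)) (m₃ rfl) k).bind fun K₄ s₄ m₄ => ?_
  rw [vals_subset] at m₂ m₄
  have h4 := m₄ k k.lt_succ_self
  simp only [one_add_one_eq_two] at h4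
  refine (Reach.inv_one h4 (h2.pow k)).bind fun K₅ s₅ m₅ => ?_
  refine Reach.vals_lt _ fun i hi => ?_
  have := Reach.mul_one (m₅ rfl) (s₅ (s₄ (s₃ (m₂ i hi))))
  rwa [hroot.dft_inverse_dft a hi, Ring.inverse_mul_cancel_left _ _ (h2.pow k)] at this

end DFT

/-! ### Truncated power series in one variable -/

section Univariate

open PowerSeries

variable {A : Type*} [CommRing A]

/-- Two is a unit and `ω k` is a `2 ^ k`-th root of unity suitable for the FFT. -/
structure IsFFTSeq (ω : ℕ → A) : Prop where
  isUnit_two : IsUnit (2 : A)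
  root : ∀ k, IsTwoPowRoot (ω k) k

/-- The set `K` contains `0`, `1` and the roots of unity. -/
structure HasConsts (ω : ℕ → A) (K : Set A) : Prop where
  zero : 0 ∈ K
  one : 1 ∈ K
  root : ∀ k, ω k ∈ K

theorem HasConsts.mono {ω : ℕ → A} {K K' : Set A} (h : HasConsts ω K) (hK : K ⊆ K') :
    HasConsts ω K' :=
  ⟨hK h.zero, hK h.one, fun k => hK (h.root k)⟩

/-- The first `n` coefficients of a power series. -/
def cf (f : A⟦X⟧) (n : ℕ) : Set A := vals (fun i => coeff i f) n

theorem cf_subset {f : A⟦X⟧} {n : ℕ} {K : Set A} : cf f n ⊆ K ↔ ∀ i < n, coeff i f ∈ K :=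
  vals_subset

/-- This is how a computed approximation stands in for the exact series. -/
theorem cf_congr {f g : A⟦X⟧} {n : ℕ} (h : X ^ n ∣ f - g) : cf f n = cf g n := by
  refine Set.image_congr fun i hi => ?_
  have := X_pow_dvd_iff.mp h i hi
  rwa [map_sub, sub_eq_zero] at this

theorem cf_trunc_subset {f : A⟦X⟧} {n : ℕ} {K : Set A} (h0 : 0 ∈ K) (h : cf f n ⊆ K) (m : ℕ) :
    cf (trunc n f : A⟦X⟧) m ⊆ K := by
  rw [cf_subset] at *
  intro i _
  rw [Polynomial.coeff_coe, coeff_trunc]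
  split_ifs with hi
  · exact h i hi
  · exact h0

theorem cf_one_subset {n : ℕ} {K : Set A} (h0 : 0 ∈ K) (h1 : 1 ∈ K) : cf (1 : A⟦X⟧) n ⊆ K := by
  rw [cf_subset]
  intro i _
  rw [coeff_one]
  split_ifs
  · exact h1
  · exact h0

theorem X_pow_dvd_sub_trunc (f : A⟦X⟧) (n : ℕ) : X ^ n ∣ f - (trunc n f : A⟦X⟧) := by
  refine X_pow_dvd_iff.mpr fun i hi => ?_
  rw [map_sub, Polynomial.coeff_coe, coeff_trunc, if_pos hi, sub_self]

variable {K : Set A} {f g h : A⟦X⟧} {n k : ℕ}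

theorem cf_mono {m : ℕ} (hm : m ≤ n) (hf : cf f n ⊆ K) : cf f m ⊆ K :=
  cf_subset.mpr fun i hi => cf_subset.mp hf i (hi.trans_le hm)

theorem reach_series_add (hf : cf f n ⊆ K) (hg : cf g n ⊆ K) : Reach K n (cf (f + g) n) := by
  rw [cf_subset] at hf hg
  have := Reach.vals_lt (K := K) (c := 1) (v := fun i => coeff i (f + g)) n fun i hi => by
    simpa only [map_add] using Reach.add_one (hf i hi) (hg i hi)
  rwa [mul_one] at this

theorem reach_series_sub (hf : cf f n ⊆ K) (hg : cf g n ⊆ K) : Reach K n (cf (f - g) n) := by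
  rw [cf_subset] at hf hg
  have := Reach.vals_lt (K := K) (c := 1) (v := fun i => coeff i (f - g)) n fun i hi => by
    simpa only [map_sub] using Reach.sub_one (hf i hi) (hg i hi)
  rwa [mul_one] at this

/-- The transform evaluates p at the powers of w, so products of polynomials become pointwise
products. -/
theorem dft_coeff {p : Polynomial A} (hp : p.natDegree < n) (w : A) (j : ℕ) :
    dft n w p.coeff j = p.eval (w ^ j) := by
  rw [Polynomial.eval_eq_sum_range' hp, dft]
  exact Finset.sum_congr rfl fun i _ => by rw [mul_comm i j, pow_mul]

theorem natDegree_trunc_two_pow (f : A⟦X⟧) (k : ℕ) : (trunc (2 ^ k) f).natDegree < 2 ^ k := by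
  have := natDegree_trunc_lt f (2 ^ k - 1)
  rwa [Nat.sub_add_cancel Nat.one_le_two_pow] at this

variable {ω : ℕ → A} (hω : IsFFTSeq ω)

include hω

theorem reach_series_mul (hK : HasConsts ω K) (hf : cf f (2 ^ k) ⊆ K) (hg : cf g (2 ^ k) ⊆ K) :
    Reach K (36 * (k + 1) * 2 ^ k) (cf (f * g) (2 ^ k)) := by
  set p := trunc (2 ^ k) f
  set q := trunc (2 ^ k) g
  have hp : p.natDegree < 2 ^ k := natDegree_trunc_two_pow f k
  have hq : q.natDegree < 2 ^ k := natDegree_trunc_two_pow g k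
  have h2 : 2 ^ (k + 1) = 2 * 2 ^ k := pow_succ' 2 k
  have hpq : (p * q).natDegree < 2 ^ (k + 1) := by
    have := Polynomial.natDegree_mul_le (p := p) (q := q)
    omega
  have hp' : p.natDegree < 2 ^ (k + 1) := by omega
  have hq' : q.natDegree < 2 ^ (k + 1) := by omega
  have hroot := hω.root (k + 1)
  -- Transforms of length 2^(k+1) hold the product of two truncations of degree below 2^k without
  -- wraparound. Three transforms cost 24(k+1)2^k, and the linear terms add 12·2^k.
  refine Reach.mono_cost (c := 4 * (k + 1) * 2 ^ (k + 1) + (4 * (k + 1) * 2 ^ (k + 1) +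
    (2 ^ (k + 1) * 1 + ((4 * (k + 1) + 5) * 2 ^ (k + 1) + 0)))) ?_ (by rw [h2]; nlinarith)
  refine (reach_dft (k + 1) (a := p.coeff) hK.one (hK.root (k + 1)) (fun i _ => ?_)
    hroot.pow_eq_one).bind fun K₁ s₁ m₁ => ?_
  · have := cf_subset.mp (cf_trunc_subset hK.zero hf (i + 1)) i i.lt_succ_self
    rwa [Polynomial.coeff_coe] at this
  have hK₁ := hK.mono s₁
  refine (reach_dft (k + 1) (a := q.coeff) hK₁.one (hK₁.root (k + 1)) (fun i _ => ?_)
    hroot.pow_eq_one).bind fun K₂ s₂ m₂ => ?_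
  · have := cf_subset.mp (cf_trunc_subset hK.zero hg (i + 1)) i i.lt_succ_self
    rw [Polynomial.coeff_coe] at this
    exact s₁ this
  have hK₂ := hK₁.mono s₂
  rw [vals_subset] at m₁ m₂
  refine (Reach.vals_lt (v := dft (2 ^ (k + 1)) (ω (k + 1)) (p * q).coeff) _
    fun j hj => ?_).bind fun K₃ s₃ m₃ => ?_
  · rw [dft_coeff hpq, Polynomial.eval_mul, ← dft_coeff hp',
      ← dft_coeff hq']
    exact Reach.mul_one (s₂ (m₁ j hj)) (m₂ j hj)
  have hK₃ := hK₂.mono s₃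
  refine (reach_of_dft hω.isUnit_two hK₃.one (hK₃.root (k + 1)) hroot
    (vals_subset.mp m₃)).bind fun K₄ s₄ m₄ => .done ?_
  rw [vals_subset] at m₄
  rw [cf_subset]
  intro i hi
  have := m₄ i (by omega)
  rwa [← Polynomial.coeff_coe, Polynomial.coe_mul,
    ← coeff_mul_eq_coeff_trunc_mul_trunc f g hi] at this

/-- Newton iteration for the inverse of a power series. -/
theorem reach_series_inv (hK : HasConsts ω K) (hfg : f * g = 1) (hf : cf f (2 ^ k) ⊆ K) :
    Reach K (150 * (k + 1) * 2 ^ k) (cf g (2 ^ k)) := by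
  induction k with
  | zero =>
    have h0 : coeff 0 f * coeff 0 g = 1 := by
      have := congrArg (coeff 0) hfg
      simpa using this
    have hu : IsUnit (coeff 0 f) := .of_mul_eq_one _ h0
    refine Reach.mono_cost (c := 1 + 0) ?_ (by norm_num)
    refine (Reach.inv_one (cf_subset.mp hf 0 (by simp)) hu).bind fun K₁ _ m₁ => .done ?_
    rw [cf_subset]
    intro i hi
    obtain rfl : i = 0 := by simpa using hi
    rw [← Ring.inverse_mul_cancel_left _ (coeff 0 g) hu, h0, mul_one]
    exact m₁ rfl
  | succ k ih =>
    have h2 : 2 ^ (k + 1) = 2 * 2 ^ k := pow_succ' 2 k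
    set N := 2 ^ (k + 1) with hN
    -- A constant c works once the two products at doubled length, about 144(k+1)2^k, fit into the
    -- growth from c to 2c; 150 leaves room for the lower-order terms.
    refine Reach.mono_cost (c := 150 * (k + 1) * 2 ^ k + (36 * (k + 1 + 1) * N + (N +
      (36 * (k + 1 + 1) * N + N)))) ?_ (by rw [h2]; nlinarith)
    refine (ih (cf_mono (by omega) hf)).bind fun K₁ s₁ m₁ => ?_
    have hK₁ := hK.mono s₁
    have m₁' := cf_trunc_subset hK₁.zero m₁ N
    set t : A⟦X⟧ := (trunc (2 ^ k) g : A⟦X⟧)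
    refine (reach_series_mul hω hK₁ (hf.trans s₁) m₁').bind fun K₂ s₂ m₂ => ?_
    have hK₂ := hK₁.mono s₂
    refine (reach_series_sub (cf_one_subset hK₂.zero hK₂.one) m₂).bind fun K₃ s₃ m₃ => ?_
    have hK₃ := hK₂.mono s₃
    have m₁₃ := (m₁'.trans s₂).trans s₃
    refine (reach_series_mul hω hK₃ m₁₃ m₃).bind fun K₄ s₄ m₄ => ?_
    have := reach_series_add (m₁₃.trans s₄) m₄
    rwa [cf_congr (g := t + t * (1 - f * t))]
    obtain ⟨e, he⟩ : X ^ 2 ^ k ∣ g - t := X_pow_dvd_sub_trunc g _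
    -- Since fg = 1, the new error is g - t - t(1 - ft) = f(g - t)², so the precision doubles.
    refine ⟨f * e ^ 2, ?_⟩
    have hX : (X : A⟦X⟧) ^ N = X ^ 2 ^ k * X ^ 2 ^ k := by rw [← pow_add, h2, two_mul]
    have ht : t = g - X ^ 2 ^ k * e := by rw [← he]; ring
    rw [hX, ht]
    linear_combination (g - X ^ 2 ^ k * e * 2) * hfg

/-- As f is invertible, the congruence determines h modulo X^(2^k); hence an inversion and a product
suffice, and 186 = 150 + 36. -/
theorem reach_series_div (hK : HasConsts ω K) (hu : IsUnit (constantCoeff f))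
    (hh : X ^ 2 ^ k ∣ h * f - g) (hf : cf f (2 ^ k) ⊆ K) (hg : cf g (2 ^ k) ⊆ K) :
    Reach K (186 * (k + 1) * 2 ^ k) (cf h (2 ^ k)) := by
  obtain ⟨f', hf'⟩ := (isUnit_iff_constantCoeff.mpr hu).exists_right_inv
  refine Reach.mono_cost (c := 150 * (k + 1) * 2 ^ k + 36 * (k + 1) * 2 ^ k) ?_ (by nlinarith)
  refine (reach_series_inv hω hK hf' hf).bind fun K₁ s₁ m₁ => ?_
  rw [cf_congr (g := g * f')]
  · exact reach_series_mul hω (hK.mono s₁) (hg.trans s₁) m₁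
  · have : h - g * f' = f' * (h * f - g) := by linear_combination -h * hf'
    rw [this]
    exact hh.mul_left _

/-- The logarithm is the integral of f'/f: one division, then termwise division by the indices. -/
theorem reach_series_log (hK : HasConsts ω K)
    (hn : ∀ i : ℕ, 0 < i → i < 2 ^ k → IsUnit (i : A))
    (hf1 : constantCoeff f = 1) (hh0 : constantCoeff h = 0)
    (hh : X ^ (2 ^ k - 1) ∣ derivative A h * f - derivative A f) (hf : cf f (2 ^ k) ⊆ K) :
    Reach K (190 * (k + 1) * 2 ^ k) (cf h (2 ^ k)) := by
  obtain ⟨n, hN⟩ : ∃ n, 2 ^ k = n + 1 := Nat.exists_eq_add_of_le' Nat.one_le_two_pow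
  rw [hN, Nat.add_sub_cancel] at hh
  -- The 2^k known coefficients of f give only n = 2^k - 1 coefficients of its derivative.
  -- Truncation pads with zeros, so the division of length 2^k applies, and its result is right
  -- modulo X^n.
  set u : A⟦X⟧ := (trunc n (derivative A f) : A⟦X⟧)
  have hu : IsUnit (constantCoeff f) := hf1 ▸ isUnit_one
  obtain ⟨f', hf'⟩ := (isUnit_iff_constantCoeff.mpr hu).exists_right_inv
  refine Reach.mono_cost (c := n + (n * 1 + (186 * (k + 1) * 2 ^ k + (n * (1 + 1) + 0)))) ?_
    (by rw [hN]; nlinarith)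
  refine (Reach.natCast_vals hK.zero hK.one n).bind fun K₁ s₁ m₁ => ?_
  rw [vals_subset] at m₁
  refine (Reach.vals_lt (v := fun i => coeff i (derivative A f)) n fun i hi => ?_).bind
    fun K₂ s₂ m₂ => ?_
  · have := Reach.mul_one (s₁ (cf_subset.mp hf (i + 1) (by omega))) (m₁ (i + 1) (by omega))
    rwa [Nat.cast_succ, ← coeff_derivative] at this
  have hK₂ := (hK.mono s₁).mono s₂
  have m₂' : cf u (2 ^ k) ⊆ K₂ := cf_trunc_subset hK₂.zero m₂ _
  refine (reach_series_div hω (h := u * f') hK₂ hu ⟨0, by linear_combination u * hf'⟩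
    ((hf.trans s₁).trans s₂) m₂').bind fun K₃ s₃ m₃ => ?_
  have hK₃ := hK₂.mono s₃
  have key : X ^ n ∣ derivative A h - u * f' := by
    have : derivative A h - u * f' = f' * (derivative A h * f - derivative A f) +
        f' * (derivative A f - u) := by linear_combination -derivative A h * hf'
    rw [this]
    exact (hh.mul_left _).add ((X_pow_dvd_sub_trunc _ _).mul_left _)
  have m₃' := (cf_congr key).trans_subset (cf_mono (by omega) m₃)
  rw [cf_subset] at m₃'
  refine (Reach.vals_lt (v := fun i => coeff (i + 1) h) n fun i hi => ?_).bind (c' := 0)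
    fun K₄ s₄ m₄ => .done ?_
  · have hi' : IsUnit ((i + 1 : ℕ) : A) := hn (i + 1) i.succ_pos (by omega)
    refine (Reach.inv_one (s₃ (s₂ (m₁ (i + 1) (by omega)))) hi').bind fun K₄ s₄ m₄ => ?_
    have := Reach.mul_one (s₄ (m₃' i hi)) (m₄ rfl)
    rwa [coeff_derivative, ← Nat.cast_succ, Ring.mul_inverse_cancel_right _ _ hi'] at this
  · rw [cf_subset]
    intro i hi
    rcases i with _ | i
    · rw [coeff_zero_eq_constantCoeff_apply, hh0]
      exact s₄ hK₃.zero
    · exact vals_subset.mp m₄ i (by omega)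

omit hω

/-- Integration regains the order lost by differentiation, because the indices below N are
invertible. -/
theorem X_pow_dvd_of_derivative {N : ℕ} (hn : ∀ i : ℕ, 0 < i → i < N → IsUnit (i : A))
    (h0 : constantCoeff f = 0) (hf : X ^ (N - 1) ∣ derivative A f) : X ^ N ∣ f := by
  refine X_pow_dvd_iff.mpr fun i hi => ?_
  rcases i with _ | i
  · rw [coeff_zero_eq_constantCoeff_apply, h0]
  · have := X_pow_dvd_iff.mp hf i (by omega)
    rw [coeff_derivative, ← Nat.cast_succ] at this
    exact (hn (i + 1) i.succ_pos hi).mul_left_eq_zero.mp this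

theorem X_pow_dvd_derivative {N : ℕ} (hf : X ^ N ∣ f) : X ^ (N - 1) ∣ derivative A f := by
  refine X_pow_dvd_iff.mpr fun i hi => ?_
  rw [coeff_derivative, X_pow_dvd_iff.mp hf (i + 1) (by omega), zero_mul]

/-- A logarithm modulo `X ^ N`. -/
theorem exists_series_log {N : ℕ} (hn : ∀ i : ℕ, 0 < i → i < N → IsUnit (i : A))
    (hf1 : constantCoeff f = 1) :
    ∃ h : A⟦X⟧, constantCoeff h = 0 ∧ X ^ (N - 1) ∣ derivative A h * f - derivative A f := by
  obtain ⟨f', hf'⟩ := (isUnit_iff_constantCoeff.mpr (hf1 ▸ isUnit_one :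
    IsUnit (constantCoeff f))).exists_right_inv
  -- At i = 0 the inverse of 0 is 0 by convention, which makes the constant term vanish; the
  -- truncated i - 1 is then harmless.
  refine ⟨mk fun i => Ring.inverse (i : A) * coeff (i - 1) (derivative A f * f'), ?_, ?_⟩
  · rw [← coeff_zero_eq_constantCoeff_apply, coeff_mk]
    simp
  · set h : A⟦X⟧ := mk fun i => Ring.inverse (i : A) * coeff (i - 1) (derivative A f * f')
    have : X ^ (N - 1) ∣ derivative A h - derivative A f * f' := by
      refine X_pow_dvd_iff.mpr fun i hi => ?_
      rw [map_sub, coeff_derivative, coeff_mk, ← Nat.cast_succ, mul_right_comm,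
        Ring.inverse_mul_cancel _ (hn (i + 1) i.succ_pos (by omega)), one_mul,
        Nat.add_sub_cancel, sub_self]
    have e : derivative A h * f - derivative A f = (derivative A h - derivative A f * f') * f := by
      linear_combination derivative A f * hf'
    rw [e]
    exact this.mul_right _

/-- One step of the Newton iteration for the exponential. -/
theorem exp_newton_step {m : ℕ} (hm : 0 < m)
    (hn : ∀ i : ℕ, 0 < i → i < 2 * m → IsUnit (i : A)) {E t L : A⟦X⟧}
    (hf0 : constantCoeff f = 0) (hE1 : constantCoeff E = 1)
    (hE : X ^ (2 * m - 1) ∣ derivative A E - derivative A f * E) (ht : X ^ m ∣ E - t)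
    (hL0 : constantCoeff L = 0)
    (hL : X ^ (2 * m - 1) ∣ derivative A L * t - derivative A t) :
    X ^ (2 * m) ∣ E - (t + t * (f - L)) := by
  obtain ⟨E', hE'⟩ := (isUnit_iff_constantCoeff.mpr (hE1 ▸ isUnit_one :
    IsUnit (constantCoeff E))).exists_right_inv
  -- The relative error of t, so that t = E(1 + u) with X^m dividing u.
  set u : A⟦X⟧ := E' * t - 1 with hu
  have htE : t = E + E * u := by rw [hu]; linear_combination -t * hE'
  have hXu : X ^ m ∣ u := by
    have : u = -E' * (E - t) := by rw [hu]; linear_combination hE'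
    rw [this]
    exact ht.mul_left _
  have hu0 : constantCoeff u = 0 := by
    have := X_pow_dvd_iff.mp hXu 0 hm
    rwa [coeff_zero_eq_constantCoeff_apply] at this
  have ht1 : constantCoeff t = 1 := by rw [htE]; simp [hu0, hE1]
  obtain ⟨t', ht'⟩ := (isUnit_iff_constantCoeff.mpr (ht1 ▸ isUnit_one :
    IsUnit (constantCoeff t))).exists_right_inv
  have hdt : derivative A t = derivative A E + (derivative A E * u + E * derivative A u) := by
    conv_lhs => rw [htE]
    rw [map_add, Derivation.leibniz]
    simp only [smul_eq_mul]
    ring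
  have huu : X ^ (2 * m - 1) ∣ u * derivative A u := by
    have := mul_dvd_mul hXu (X_pow_dvd_derivative hXu)
    rwa [← pow_add, ← Nat.add_sub_assoc hm, ← two_mul] at this
  -- Formally log t = log E + log(1 + u) = f + u + O(u²). This is proved by comparing derivatives,
  -- where the only quadratic term is u u'.
  have hD : X ^ (2 * m) ∣ L - f - u := by
    refine X_pow_dvd_of_derivative hn (by simp [hL0, hf0, hu0]) ?_
    have : derivative A (L - f - u) = t' * (derivative A L * t - derivative A t) +
        t' * (1 + u) * (derivative A E - derivative A f * E) - t' * E * (u * derivative A u) := by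
      rw [hdt, map_sub, map_sub, htE]
      rw [htE] at ht'
      linear_combination -(derivative A L - derivative A f - derivative A u) * ht'
    rw [this]
    exact ((hL.mul_left _).add (hE.mul_left _)).sub (huu.mul_left _)
  -- An exact identity; both summands are divisible by X^(2m), so the Newton step doubles the
  -- precision.
  have : E - (t + t * (f - L)) = t * (L - f - u) + E * (u * u) := by
    rw [htE]; ring
  rw [this]
  refine (hD.mul_left _).add (Dvd.dvd.mul_left ?_ _)
  rw [two_mul, pow_add]
  exact mul_dvd_mul hXu hXu

include hω

/-- Newton iteration for the exponential of a power series. -/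
theorem reach_series_exp {E : A⟦X⟧} (hK : HasConsts ω K)
    (hn : ∀ i : ℕ, 0 < i → i < 2 ^ k → IsUnit (i : A))
    (hf0 : constantCoeff f = 0) (hE1 : constantCoeff E = 1)
    (hE : X ^ (2 ^ k - 1) ∣ derivative A E - derivative A f * E) (hf : cf f (2 ^ k) ⊆ K) :
    Reach K (460 * (k + 1) * 2 ^ k) (cf E (2 ^ k)) := by
  induction k with
  | zero =>
    refine .done (cf_subset.mpr fun i hi => ?_)
    obtain rfl : i = 0 := by simpa using hi
    rw [coeff_zero_eq_constantCoeff_apply, hE1]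
    exact hK.one
  | succ k ih =>
    have h2 : 2 ^ (k + 1) = 2 * 2 ^ k := pow_succ' 2 k
    have hpos : 0 < 2 ^ k := Nat.two_pow_pos k
    -- A doubling costs a logarithm, a product and two linear passes. The requirement is 2·(190 +
    -- 36) = 452 plus a small margin.
    refine Reach.mono_cost (c := 460 * (k + 1) * 2 ^ k + (190 * (k + 1 + 1) * 2 ^ (k + 1) +
      (2 ^ (k + 1) + (36 * (k + 1 + 1) * 2 ^ (k + 1) + 2 ^ (k + 1))))) ?_ (by rw [h2]; nlinarith)
    refine (ih (fun i hi hi' => hn i hi (by omega)) ((pow_dvd_pow _ (by omega)).trans hE)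
      (cf_mono (by omega) hf)).bind fun K₁ s₁ m₁ => ?_
    have hK₁ := hK.mono s₁
    have m₁' := cf_trunc_subset hK₁.zero m₁ (2 ^ (k + 1))
    have ht := X_pow_dvd_sub_trunc E (2 ^ k)
    set t : A⟦X⟧ := (trunc (2 ^ k) E : A⟦X⟧)
    have ht1 : constantCoeff t = 1 := by
      have := X_pow_dvd_iff.mp ht 0 hpos
      rwa [coeff_zero_eq_constantCoeff_apply, map_sub, hE1, sub_eq_zero, eq_comm] at this
    obtain ⟨L, hL0, hL⟩ := exists_series_log hn ht1
    refine (reach_series_log hω hK₁ hn ht1 hL0 hL m₁').bind fun K₂ s₂ m₂ => ?_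
    refine (reach_series_sub ((hf.trans s₁).trans s₂) m₂).bind fun K₃ s₃ m₃ => ?_
    have m₁₃ := (m₁'.trans s₂).trans s₃
    refine (reach_series_mul hω ((hK₁.mono s₂).mono s₃) m₁₃ m₃).bind fun K₄ s₄ m₄ => ?_
    rw [h2] at hn hE hL ⊢
    rw [cf_congr (exp_newton_step hpos hn hf0 hE1 hE ht hL0 hL), ← h2]
    exact reach_series_add (m₁₃.trans s₄) m₄

end Univariate

/-! ### Evaluation of polynomials in several variables by Kronecker substitution -/

section Kronecker

open MvPolynomial

variable {A : Type*} [CommRing A]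

/-- The exponent vector given by the digits of `n` in base `d`. -/
noncomputable def digitVector {r d : ℕ} (g : Fin r → Fin d) : Fin r →₀ ℕ :=
  Finsupp.equivFunOnFinite.symm fun t => (g t : ℕ)

theorem digitVector_injective (r d : ℕ) : Function.Injective (digitVector (r := r) (d := d)) := by
  intro g g' h
  funext t
  exact Fin.ext (DFunLike.congr_fun h t)

theorem exists_digitVector {r d : ℕ} {a : Fin r →₀ ℕ} (ha : a.degree < d) :
    ∃ g : Fin r → Fin d, digitVector g = a :=
  ⟨fun t => ⟨a t, (Finsupp.le_degree t a).trans_lt ha⟩, by ext t; rfl⟩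

/-- Evaluation at the point `(ζ ^ j, ζ ^ (j * d), ζ ^ (j * d ^ 2), …)`. -/
noncomputable def kroneckerEval (r d : ℕ) (ζ : A) (j : ℕ) : MvPolynomial (Fin r) A →+* A :=
  eval fun t => ζ ^ (d ^ (t : ℕ) * j)

/-- The coefficients of a polynomial, in the order given by Kronecker substitution. -/
noncomputable def kroneckerVector {r d : ℕ} (p : MvPolynomial (Fin r) A) (n : ℕ) : A :=
  if h : n < d ^ r then p.coeff (digitVector (finFunctionFinEquiv.symm ⟨n, h⟩)) else 0

/-- A monomial with exponent vector a takes the value ζ^(j Σ a_t d^t). Since all a_t < d, these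
exponents have distinct base-d expansions, so the evaluations form a transform in one variable. -/
theorem dft_kroneckerVector {r d : ℕ} {p : MvPolynomial (Fin r) A} (hp : p.totalDegree < d)
    (ζ : A) (j : ℕ) :
    dft (d ^ r) ζ (kroneckerVector (d := d) p) j = kroneckerEval r d ζ j p := by
  classical
  have hsub : p.support ⊆ Finset.univ.image (digitVector (r := r) (d := d)) := fun a ha => by
    obtain ⟨g, hg⟩ := exists_digitVector (d := d) (a := a)
      (lt_of_le_of_lt (by
        rw [Finsupp.degree_apply]; exact le_totalDegree ha) hp)
    exact Finset.mem_image.mpr ⟨g, Finset.mem_univ _, hg⟩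
  rw [kroneckerEval, eval_eq', Finset.sum_subset hsub, Finset.sum_image
    fun g _ g' _ h => digitVector_injective r d h, dft, Finset.sum_range,
    ← finFunctionFinEquiv.sum_comp]
  · refine Finset.sum_congr rfl fun g _ => ?_
    rw [kroneckerVector, dif_pos (Fin.is_lt _), Fin.eta, Equiv.symm_apply_apply,
      finFunctionFinEquiv_apply, Finset.sum_mul, ← Finset.prod_pow_eq_pow_sum]
    refine congrArg _ (Finset.prod_congr rfl fun t _ => ?_)
    rw [← pow_mul]
    congr 1
    simp only [digitVector, Finsupp.equivFunOnFinite_symm_apply_apply]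
    ring
  · intro a _ ha
    rw [notMem_support_iff.mp ha, zero_mul]

variable {K : Set A} {ω : ℕ → A} (hω : IsFFTSeq ω) {r ℓ : ℕ} {p : MvPolynomial (Fin r) A}

include hω

theorem reach_kroneckerEval (hK : HasConsts ω K) (hp : p.totalDegree < 2 ^ ℓ)
    (h : ∀ a, p.coeff a ∈ K) :
    Reach K (4 * (ℓ * r) * 2 ^ (ℓ * r))
      (vals (fun j => kroneckerEval r (2 ^ ℓ) (ω (ℓ * r)) j p) (2 ^ (ℓ * r))) := by
  have := reach_dft (ℓ * r) (K := K) (a := kroneckerVector (d := 2 ^ ℓ) p) hK.one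
    (hK.root (ℓ * r)) (fun i _ => by
      rw [kroneckerVector]
      split_ifs
      · exact h _
      · exact hK.zero) (hω.root (ℓ * r)).pow_eq_one
  convert this using 2
  funext j
  rw [pow_mul, dft_kroneckerVector hp]

theorem reach_of_kroneckerEval (hK : HasConsts ω K) (hp : p.totalDegree < 2 ^ ℓ)
    (h : ∀ j < 2 ^ (ℓ * r), kroneckerEval r (2 ^ ℓ) (ω (ℓ * r)) j p ∈ K) :
    Reach K ((4 * (ℓ * r) + 5) * 2 ^ (ℓ * r)) (Set.range fun a => p.coeff a) := by
  refine Reach.bind (c' := 0) (reach_of_dft (a := kroneckerVector (d := 2 ^ ℓ) p) hω.isUnit_two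
    hK.one (hK.root (ℓ * r)) (hω.root (ℓ * r)) fun j hj => ?_) fun K₁ s₁ m₁ => .done ?_
  · have := h j hj
    rwa [← dft_kroneckerVector hp, ← pow_mul] at this
  · rw [vals_subset] at m₁
    rintro _ ⟨a, rfl⟩
    by_cases ha : a.degree < 2 ^ ℓ
    · obtain ⟨g, rfl⟩ := exists_digitVector ha
      have := m₁ (finFunctionFinEquiv g) (by rw [pow_mul]; exact Fin.is_lt _)
      rwa [kroneckerVector, dif_pos (Fin.is_lt _), Fin.eta, Equiv.symm_apply_apply] at this
    -- All but finitely many coefficients vanish for degree reasons, and 0 is already available.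
    · have h0 : p.coeff a = 0 := coeff_eq_zero_of_totalDegree_lt (by
        rw [Finsupp.degree_apply] at ha
        exact hp.trans_le (not_lt.mp ha))
      simp only [h0]
      exact s₁ hK.zero

end Kronecker

/-! ### Operations on regular series, point by point -/

section Regular

variable {A : Type*} [CommRing A]

/-- All coefficients of `f` modulo `s ^ d`. -/
def regSet {r : ℕ} (f : YSeries A r) (d : ℕ) : Set A :=
  ⋃ i < d, Set.range fun a => (PowerSeries.coeff i f).coeff a

theorem regSet_subset {r d : ℕ} {f : YSeries A r} {K : Set A} :
    regSet f d ⊆ K ↔ ∀ i < d, ∀ a, (PowerSeries.coeff i f).coeff a ∈ K := by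
  simp only [regSet, Set.iUnion₂_subset_iff, Set.range_subset_iff]

/-- The series in one variable obtained from `f` by evaluation at a point. -/
noncomputable def pointSeries (r d : ℕ) (ζ : A) (j : ℕ) : YSeries A r →+* PowerSeries A :=
  PowerSeries.map (kroneckerEval r d ζ j)

variable {K : Set A} {ω : ℕ → A} (hω : IsFFTSeq ω) {r ℓ : ℕ} {f g h : YSeries A r}

include hω

/-- Regularity enters here: the coefficient of s^i has degree at most i < 2^ℓ, as Kronecker
substitution requires. -/
theorem reach_pointSeries (hK : HasConsts ω K) (hf : f ∈ regularSeries A r)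
    (hfK : regSet f (2 ^ ℓ) ⊆ K) :
    Reach K (2 ^ ℓ * (4 * (ℓ * r) * 2 ^ (ℓ * r)))
      (⋃ j < 2 ^ (ℓ * r), cf (pointSeries r (2 ^ ℓ) (ω (ℓ * r)) j f) (2 ^ ℓ)) := by
  rw [regSet_subset] at hfK
  refine (Reach.iUnion_lt (2 ^ ℓ) fun i hi => reach_kroneckerEval hω hK ((hf i).trans_lt hi)
    (hfK i hi)).bind (c' := 0) fun K₁ s₁ m₁ => .done ?_
  refine Set.iUnion₂_subset fun j hj => cf_subset.mpr fun i hi => ?_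
  refine m₁ (Set.mem_iUnion₂.mpr ⟨i, hi, j, hj, ?_⟩)
  simp [pointSeries]

theorem reach_of_pointSeries (hK : HasConsts ω K) (hf : f ∈ regularSeries A r)
    (hfK : ∀ j < 2 ^ (ℓ * r), cf (pointSeries r (2 ^ ℓ) (ω (ℓ * r)) j f) (2 ^ ℓ) ⊆ K) :
    Reach K (2 ^ ℓ * ((4 * (ℓ * r) + 5) * 2 ^ (ℓ * r))) (regSet f (2 ^ ℓ)) := by
  refine Reach.iUnion_lt (2 ^ ℓ) fun i hi => reach_of_kroneckerEval hω hK ((hf i).trans_lt hi)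
    fun j hj => ?_
  have := cf_subset.mp (hfK j hj) i hi
  rwa [pointSeries, PowerSeries.coeff_map] at this

/-- An operation on regular series that can be performed point by point. -/
theorem reach_regular (hℓ : 1 ≤ ℓ) {c : ℕ} (hK : HasConsts ω K) (hf : f ∈ regularSeries A r)
    (hg : g ∈ regularSeries A r) (hh : h ∈ regularSeries A r)
    (hop : ∀ (j : ℕ) (K' : Set A), HasConsts ω K' →
      cf (pointSeries r (2 ^ ℓ) (ω (ℓ * r)) j f) (2 ^ ℓ) ⊆ K' →
      cf (pointSeries r (2 ^ ℓ) (ω (ℓ * r)) j g) (2 ^ ℓ) ⊆ K' →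
      Reach K' (c * (ℓ + 1) * 2 ^ ℓ) (cf (pointSeries r (2 ^ ℓ) (ω (ℓ * r)) j h) (2 ^ ℓ)))
    (hfK : regSet f (2 ^ ℓ) ⊆ K) (hgK : regSet g (2 ^ ℓ) ⊆ K) :
    Reach K ((17 + 2 * c) * (2 ^ ℓ) ^ (r + 1) * (ℓ * (r + 1))) (regSet h (2 ^ ℓ)) := by
  -- Two families of forward transforms, one univariate operation per point, and one family of
  -- inverse transforms. Since ℓ ≥ 1, both 5 and c(ℓ+1) are absorbed into multiples of ℓ(r+1).
  refine Reach.mono_cost (c := 2 ^ ℓ * (4 * (ℓ * r) * 2 ^ (ℓ * r)) +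
    (2 ^ ℓ * (4 * (ℓ * r) * 2 ^ (ℓ * r)) + (2 ^ (ℓ * r) * (c * (ℓ + 1) * 2 ^ ℓ) +
      2 ^ ℓ * ((4 * (ℓ * r) + 5) * 2 ^ (ℓ * r))))) ?_ ?_
  · refine (reach_pointSeries hω hK hf hfK).bind fun K₁ s₁ m₁ => ?_
    have hK₁ := hK.mono s₁
    refine (reach_pointSeries hω hK₁ hg (hgK.trans s₁)).bind fun K₂ s₂ m₂ => ?_
    have hK₂ := hK₁.mono s₂
    rw [Set.iUnion₂_subset_iff] at m₁ m₂
    refine (Reach.iUnion_lt (2 ^ (ℓ * r)) fun j hj => hop j K₂ hK₂ ((m₁ j hj).trans s₂)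
      (m₂ j hj)).bind fun K₃ s₃ m₃ => ?_
    exact reach_of_pointSeries hω (hK₂.mono s₃) hh (Set.iUnion₂_subset_iff.mp m₃)
  · have e : (2 ^ ℓ) ^ (r + 1) = 2 ^ ℓ * 2 ^ (ℓ * r) := by rw [pow_succ', pow_mul]
    rw [e]
    calc _ = (2 ^ ℓ * 2 ^ (ℓ * r)) * (12 * (ℓ * r) + 5 + c * (ℓ + 1)) := by ring
      _ ≤ (2 ^ ℓ * 2 ^ (ℓ * r)) * ((17 + 2 * c) * (ℓ * (r + 1))) := by
        refine Nat.mul_le_mul_left _ ?_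
        have h1 : c * (ℓ + 1) ≤ 2 * c * (ℓ * (r + 1)) := by
          rw [mul_comm 2 c, mul_assoc]
          exact Nat.mul_le_mul_left _ (by nlinarith)
        nlinarith
      _ = _ := by ring

end Regular

/-! ### Explicit formulas for the operations -/

section Formulas

variable {B : Type*} [CommRing B]

/-- The quotient `g / f` modulo the `d`-th power of `1 - c * f`, where `c` is meant to be the inverse
of the constant term of `f`. -/
def geomDiv (d : ℕ) (c f g : B) : B :=
  g * c * ∑ n ∈ Finset.range d, (1 - c * f) ^ n

/-- The truncated exponential series. -/
noncomputable def expSum (d : ℕ) (f : B) : B :=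
  ∑ n ∈ Finset.range d, Ring.inverse (n.factorial : B) * f ^ n

/-- The truncated logarithm series. -/
noncomputable def logSum (d : ℕ) (f : B) : B :=
  ∑ n ∈ Finset.Ico 1 d, (-1) ^ (n + 1) * Ring.inverse (n : B) * (f - 1) ^ n

/-- The geometric series telescopes; the remaining power vanishes modulo s^d when c inverts the
constant term of f. -/
theorem geomDiv_mul_sub (d : ℕ) (c f g : B) :
    geomDiv d c f g * f - g = -g * (1 - c * f) ^ d := by
  have := geom_sum_mul (1 - c * f) d
  rw [geomDiv]
  linear_combination -g * this

theorem isUnit_factorial {d : ℕ} (hn : ∀ i : ℕ, 0 < i → i < d → IsUnit (i : B)) {n : ℕ}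
    (h : n < d) : IsUnit (n.factorial : B) := by
  induction n with
  | zero => simp
  | succ n ih =>
    rw [Nat.factorial_succ, Nat.cast_mul]
    exact (hn _ n.succ_pos h).mul (ih (by omega))

theorem isUnit_natCast_map {B' F : Type*} [CommRing B'] [FunLike F B B'] [RingHomClass F B B']
    (φ : F) {d : ℕ} (hn : ∀ i : ℕ, 0 < i → i < d → IsUnit (i : B)) :
    ∀ i : ℕ, 0 < i → i < d → IsUnit (i : B') :=
  fun i h h' => by simpa using (hn i h h').map φ

variable {B' : Type*} [CommRing B'] (φ : B →+* B') {d : ℕ}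

theorem map_geomDiv (d : ℕ) (c f g : B) :
    φ (geomDiv d c f g) = geomDiv d (φ c) (φ f) (φ g) := by
  simp [geomDiv]

/-- Homomorphisms preserve `Ring.inverse` only at units. The formula is carried to the point series,
to the quotient modulo s^d and to the factors of the product ring. -/
theorem map_expSum (hn : ∀ i : ℕ, 0 < i → i < d → IsUnit (i : B)) (f : B) :
    φ (expSum d f) = expSum d (φ f) := by
  simp only [expSum, map_sum, map_mul, map_pow]
  refine Finset.sum_congr rfl fun n h => ?_
  rw [map_ring_inverse φ (isUnit_factorial hn (Finset.mem_range.mp h)), map_natCast]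

theorem map_logSum (hn : ∀ i : ℕ, 0 < i → i < d → IsUnit (i : B)) (f : B) :
    φ (logSum d f) = logSum d (φ f) := by
  simp only [logSum, map_sum, map_mul, map_pow, map_sub, map_one, map_neg]
  refine Finset.sum_congr rfl fun n h => ?_
  rw [Finset.mem_Ico] at h
  rw [map_ring_inverse φ (hn n h.1 h.2), map_natCast]

end Formulas

/-! ### Differential equations of the truncated exponential and logarithm. -/

section Derivatives

open PowerSeries

variable {A : Type*} [CommRing A] {d : ℕ} {f : A⟦X⟧}

theorem derivative_inverse_natCast_mul {n : ℕ} (hn : IsUnit (n : A)) (f : A⟦X⟧) :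
    derivative A (Ring.inverse (n : A⟦X⟧) * f) = Ring.inverse (n : A⟦X⟧) * derivative A f := by
  have h : Ring.inverse (n : A⟦X⟧) = C (Ring.inverse (n : A)) := by
    rw [map_ring_inverse _ hn, map_natCast]
  rw [h, Derivation.leibniz, derivative_C]
  simp

theorem constantCoeff_expSum (hd : 0 < d) (hf : constantCoeff f = 0) :
    constantCoeff (expSum d f) = 1 := by
  obtain ⟨e, rfl⟩ := Nat.exists_eq_add_of_le' hd
  simp [expSum, Finset.sum_range_succ', hf]

theorem constantCoeff_logSum (hf : constantCoeff f = 1) : constantCoeff (logSum d f) = 0 := by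
  rw [logSum, map_sum]
  refine Finset.sum_eq_zero fun n hn => ?_
  have : n ≠ 0 := by have := Finset.mem_Ico.mp hn; omega
  simp [hf, this]

theorem X_pow_dvd_pow {n : ℕ} (hf : constantCoeff f = 0) : X ^ n ∣ f ^ n :=
  pow_dvd_pow_of_dvd (X_dvd_iff.mpr hf) n

/-- Differentiation shifts the sum down by one term, so the discrepancy is f' times the top term, a
multiple of f^(d-1). -/
theorem derivative_expSum (hn : ∀ i : ℕ, 0 < i → i < d → IsUnit (i : A))
    (hf : constantCoeff f = 0) :
    X ^ (d - 1) ∣ derivative A (expSum d f) - derivative A f * expSum d f := by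
  rcases d with _ | e
  · simp [expSum]
  have hu : ∀ i : ℕ, 0 < i → i < e + 1 → IsUnit (i : A⟦X⟧) := isUnit_natCast_map C hn
  have h1 : derivative A (expSum (e + 1) f) = derivative A f * expSum e f := by
    rw [expSum, map_sum, Finset.sum_range_succ', expSum, Finset.mul_sum]
    simp only [pow_zero, Nat.factorial_zero, Nat.cast_one, Ring.inverse_one, mul_one,
      derivative_one, add_zero]
    refine Finset.sum_congr rfl fun n h => ?_
    have h := Finset.mem_range.mp h
    rw [derivative_inverse_natCast_mul (isUnit_factorial hn (by omega)), derivative_pow,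
      Nat.add_sub_cancel, Nat.factorial_succ, Nat.cast_mul, Ring.mul_inverse_rev]
    have := Ring.inverse_mul_cancel _ (hu (n + 1) n.succ_pos (by omega))
    linear_combination Ring.inverse (n.factorial : A⟦X⟧) * f ^ n * derivative A f * this
  have h2 : expSum (e + 1) f = expSum e f + Ring.inverse (e.factorial : A⟦X⟧) * f ^ e := by
    rw [expSum, Finset.sum_range_succ, expSum]
  rw [h1, h2, Nat.add_sub_cancel, mul_add, sub_add_cancel_left, dvd_neg]
  exact ((X_pow_dvd_pow hf).mul_left _).mul_left _

/-- The derivative is f' times a geometric sum in 1 - f. Multiplying by f = 1 - (1 - f) telescopes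
it and leaves -f'(1 - f)^(d-1). -/
theorem derivative_logSum (hn : ∀ i : ℕ, 0 < i → i < d → IsUnit (i : A))
    (hf : constantCoeff f = 1) :
    X ^ (d - 1) ∣ derivative A (logSum d f) * f - derivative A f := by
  have hu : ∀ i : ℕ, 0 < i → i < d → IsUnit (i : A⟦X⟧) := isUnit_natCast_map C hn
  have h1 : derivative A (logSum d f) =
      derivative A f * ∑ n ∈ Finset.range (d - 1), (1 - f) ^ n := by
    rw [logSum, map_sum, Finset.sum_Ico_eq_sum_range, Finset.mul_sum]
    refine Finset.sum_congr rfl fun n h => ?_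
    have h := Finset.mem_range.mp h
    have hn' := hn (1 + n) (by omega) (by omega)
    rw [mul_comm ((-1) ^ _), mul_assoc, derivative_inverse_natCast_mul hn',
      Derivation.leibniz, derivative_pow]
    have h0 : derivative A ((-1 : A⟦X⟧) ^ (1 + n + 1)) = 0 := by
      have : (-1 : A⟦X⟧) ^ (1 + n + 1) = C ((-1) ^ (1 + n + 1)) := by simp
      rw [this, derivative_C]
    have := Ring.inverse_mul_cancel _ (hu (1 + n) (by omega) (by omega))
    rw [h0, map_sub, derivative_one, smul_zero, add_zero, sub_zero, smul_eq_mul,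
      Nat.add_sub_cancel_left, ← neg_sub f 1, neg_pow (f - 1) n]
    linear_combination (-1) ^ n * (f - 1) ^ n * derivative A f * this
  have h2 := mul_neg_geom_sum (1 - f) (d - 1)
  have h3 : derivative A (logSum d f) * f - derivative A f =
      -derivative A f * (1 - f) ^ (d - 1) := by
    rw [h1]
    linear_combination derivative A f * h2
  rw [h3]
  exact (X_pow_dvd_pow (by simp [hf])).mul_left _

end Derivatives

/-! ### Regular series with given coefficients -/

section Coefficients

open MvPolynomial

theorem regMonomial_finite (r d : ℕ) : Finite (RegMonomial r d) := by
  have : {m : Fin d × (Fin r →₀ ℕ) | m.2.degree ≤ (m.1 : ℕ)}.Finite :=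
    ((Set.finite_univ (α := Fin d)).prod (Finsupp.finite_of_degree_le (σ := Fin r) d)).subset
      fun m hm => ⟨trivial, le_trans hm m.1.is_lt.le⟩
  exact this.to_subtype

noncomputable instance (r d : ℕ) : Fintype (RegMonomial r d) :=
  @Fintype.ofFinite _ (regMonomial_finite r d)

variable {A : Type*} [CommRing A] {r d : ℕ}

/-- The regular series with the given coefficients at the monomials `s ^ i * y ^ a` with `i < d`. -/
noncomputable def ofCoeffs (x : RegMonomial r d → A) : YSeries A r :=
  ∑ m, PowerSeries.monomial (m.1.1 : ℕ) (monomial m.1.2 (x m))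

/-- The coefficient of a series at a monomial. -/
noncomputable def regCoeff (f : YSeries A r) (m : RegMonomial r d) : A :=
  (PowerSeries.coeff (m.1.1 : ℕ) f).coeff m.1.2

theorem coeff_ofCoeffs (x : RegMonomial r d → A) (i : ℕ) (a : Fin r →₀ ℕ) :
    (PowerSeries.coeff i (ofCoeffs x)).coeff a =
      if h : ∃ _ : i < d, a.degree ≤ i then x ⟨(⟨i, h.1⟩, a), h.2⟩ else 0 := by
  classical
  simp only [ofCoeffs, map_sum, PowerSeries.coeff_monomial, coeff_sum]
  split_ifs with h
  · rw [Finset.sum_eq_single ⟨(⟨i, h.1⟩, a), h.2⟩]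
    · simp
    · intro m _ hm
      split_ifs with hi
      · rw [coeff_monomial, if_neg]
        rintro rfl
        exact hm (Subtype.ext (Prod.ext (Fin.ext hi.symm) rfl))
      · simp
    · simp
  · refine Finset.sum_eq_zero fun m _ => ?_
    split_ifs with hi
    · rw [coeff_monomial, if_neg]
      rintro rfl
      exact h ⟨hi ▸ m.1.1.is_lt, hi ▸ m.2⟩
    · simp

theorem ofCoeffs_mem (x : RegMonomial r d → A) : ofCoeffs x ∈ regularSeries A r := by
  intro n
  refine Finset.sup_le fun a ha => ?_
  by_contra hn
  rw [mem_support_iff, coeff_ofCoeffs, dif_neg] at ha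
  · exact ha rfl
  · rintro ⟨_, h⟩
    exact hn h

theorem regSet_ofCoeffs {K : Set A} (x : RegMonomial r d → A) (h0 : 0 ∈ K)
    (hx : Set.range x ⊆ K) (n : ℕ) : regSet (ofCoeffs x) n ⊆ K := by
  rw [regSet_subset]
  intro i _ a
  rw [coeff_ofCoeffs]
  split_ifs
  · exact hx ⟨_, rfl⟩
  · exact h0

theorem range_regCoeff_subset (f : YSeries A r) :
    Set.range (regCoeff (d := d) f) ⊆ regSet f d := by
  rintro _ ⟨m, rfl⟩
  exact regSet_subset.mp subset_rfl _ m.1.1.is_lt _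

/-- A homomorphism of the rings of coefficients. -/
noncomputable def mapY {A' : Type*} [CommRing A'] (r : ℕ) (φ : A →+* A') :
    YSeries A r →+* YSeries A' r :=
  PowerSeries.map (MvPolynomial.map φ)

theorem mapY_ofCoeffs {A' : Type*} [CommRing A'] (φ : A →+* A') (x : RegMonomial r d → A) :
    mapY r φ (ofCoeffs x) = ofCoeffs fun m => φ (x m) := by
  ext i a
  rw [mapY, PowerSeries.coeff_map, coeff_map, coeff_ofCoeffs, coeff_ofCoeffs]
  split_ifs <;> simp

theorem regCoeff_mapY {A' : Type*} [CommRing A'] (φ : A →+* A') (f : YSeries A r)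
    (m : RegMonomial r d) : regCoeff (mapY r φ f) m = φ (regCoeff f m) := by
  rw [regCoeff, mapY, PowerSeries.coeff_map, coeff_map, regCoeff]

theorem regCoeffs_mk (f : YSeries A r) :
    regCoeffs (Ideal.Quotient.mk _ f : YTrunc A r d) = regCoeff f :=
  rfl

theorem sCoeff_mk (f : YSeries A r) (i : Fin d) :
    sCoeff i (Ideal.Quotient.mk _ f : YTrunc A r d) = PowerSeries.coeff (i : ℕ) f :=
  rfl

theorem mk_eq_mk {f g : YSeries A r} (h : PowerSeries.X ^ d ∣ f - g) :
    (Ideal.Quotient.mk _ f : YTrunc A r d) = Ideal.Quotient.mk _ g :=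
  Ideal.Quotient.eq.mpr (Ideal.mem_span_singleton.mpr h)

/-- A class of regular series is determined by its coefficients. -/
theorem mk_ofCoeffs_regCoeffs {F : YTrunc A r d} (hF : F ∈ regularTrunc A r d) :
    Ideal.Quotient.mk _ (ofCoeffs (regCoeffs F)) = F := by
  obtain ⟨f, hf, rfl⟩ := hF
  refine mk_eq_mk (PowerSeries.X_pow_dvd_iff.mpr fun i hi => ?_)
  ext a
  rw [map_sub, coeff_sub, coeff_ofCoeffs, coeff_zero, sub_eq_zero]
  split_ifs with h
  · rfl
  · refine (coeff_eq_zero_of_totalDegree_lt ((hf i).trans_lt ?_)).symm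
    rw [← Finsupp.degree_apply]
    by_contra h'
    exact h ⟨hi, not_lt.mp h'⟩

/-- The monomial `1`. -/
def oneMonomial (r : ℕ) {d : ℕ} (hd : 0 < d) : RegMonomial r d :=
  ⟨(⟨0, hd⟩, 0), by simp⟩

theorem coeff_zero_ofCoeffs (hd : 0 < d) (x : RegMonomial r d → A) :
    PowerSeries.constantCoeff (ofCoeffs x) = C (x (oneMonomial r hd)) := by
  ext a
  rw [← PowerSeries.coeff_zero_eq_constantCoeff_apply, coeff_ofCoeffs, coeff_C]
  by_cases ha : a = 0
  · subst ha
    rw [dif_pos ⟨hd, by simp⟩, if_pos rfl]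
    rfl
  · rw [dif_neg, if_neg (Ne.symm ha)]
    rintro ⟨_, h⟩
    exact ha ((Finsupp.degree_eq_zero_iff _).mp (Nat.le_zero.mp h))

theorem sCoeff_zero_of_mem (hd : 0 < d) {F : YTrunc A r d} (hF : F ∈ regularTrunc A r d) :
    sCoeff ⟨0, hd⟩ F = C (regCoeffs F (oneMonomial r hd)) := by
  conv_lhs => rw [← mk_ofCoeffs_regCoeffs hF]
  rw [sCoeff_mk, ← coeff_zero_ofCoeffs, PowerSeries.coeff_zero_eq_constantCoeff_apply]

/-- The constant `c` as a series. -/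
noncomputable def constY (r : ℕ) : A →+* YSeries A r :=
  (PowerSeries.C (R := MvPolynomial (Fin r) A)).comp C

theorem constY_mem (c : A) : constY r c ∈ regularSeries A r := by
  intro n
  rw [constY, RingHom.comp_apply, PowerSeries.coeff_C]
  split_ifs <;> simp

theorem mapY_constY {A' : Type*} [CommRing A'] (φ : A →+* A') (c : A) :
    mapY r φ (constY r c) = constY r (φ c) := by
  simp [mapY, constY]

theorem pointSeries_constY (ζ : A) (j : ℕ) (c : A) :
    pointSeries r d ζ j (constY r c) = PowerSeries.C c := by
  simp [pointSeries, constY, kroneckerEval]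

theorem constantCoeff_pointSeries (ζ : A) (j : ℕ) (f : YSeries A r) :
    PowerSeries.constantCoeff (pointSeries r d ζ j f) =
      kroneckerEval r d ζ j (PowerSeries.constantCoeff f) := by
  rw [← PowerSeries.coeff_zero_eq_constantCoeff_apply, pointSeries, PowerSeries.coeff_map,
    PowerSeries.coeff_zero_eq_constantCoeff_apply]

/-- In order 0 regularity permits only the monomial 1. All point series thus share one constant
term, so a hypothesis on it holds at every point. -/
theorem constantCoeff_pointSeries_ofCoeffs (hd : 0 < d) (ζ : A) (j : ℕ)
    (x : RegMonomial r d → A) :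
    PowerSeries.constantCoeff (pointSeries r d ζ j (ofCoeffs x)) = x (oneMonomial r hd) := by
  rw [constantCoeff_pointSeries, coeff_zero_ofCoeffs hd]
  simp [kroneckerEval]

theorem inverse_natCast_mem {n : ℕ} (hn : IsUnit (n : A)) :
    Ring.inverse (n : YSeries A r) ∈ regularSeries A r := by
  rw [← map_natCast (constY r) n, ← map_ring_inverse _ hn]
  exact constY_mem _

theorem geomDiv_mem {c f g : YSeries A r} (hc : c ∈ regularSeries A r)
    (hf : f ∈ regularSeries A r) (hg : g ∈ regularSeries A r) (d : ℕ) :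
    geomDiv d c f g ∈ regularSeries A r :=
  mul_mem (mul_mem hg hc) (sum_mem fun _ _ => pow_mem (sub_mem (one_mem _) (mul_mem hc hf)) _)

theorem expSum_mem (hn : ∀ i : ℕ, 0 < i → i < d → IsUnit (i : A)) {f : YSeries A r}
    (hf : f ∈ regularSeries A r) : expSum d f ∈ regularSeries A r :=
  sum_mem fun _ h => mul_mem
    (inverse_natCast_mem (isUnit_factorial hn (Finset.mem_range.mp h))) (pow_mem hf _)

theorem logSum_mem (hn : ∀ i : ℕ, 0 < i → i < d → IsUnit (i : A)) {f : YSeries A r}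
    (hf : f ∈ regularSeries A r) : logSum d f ∈ regularSeries A r :=
  sum_mem fun _ h => mul_mem (mul_mem (pow_mem (neg_mem (one_mem _)) _)
    (inverse_natCast_mem (hn _ (Finset.mem_Ico.mp h).1 (Finset.mem_Ico.mp h).2)))
      (pow_mem (sub_mem hf (one_mem _)) _)

end Coefficients

/-! ### Costs of the four operations over a single ring -/

section Operations

variable {A : Type*} [CommRing A] {K : Set A} {ω : ℕ → A} (hω : IsFFTSeq ω) {r ℓ : ℕ}
  (hℓ : 1 ≤ ℓ) (hK : HasConsts ω K) {x y : RegMonomial r (2 ^ ℓ) → A}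
  (hx : Set.range x ⊆ K) (hy : Set.range y ⊆ K)

include hω hℓ hK hx

section Binary

include hy

theorem reach_mul : Reach K (1000 * (2 ^ ℓ) ^ (r + 1) * (ℓ * (r + 1)))
    (regSet (ofCoeffs x * ofCoeffs y) (2 ^ ℓ)) := by
  refine Reach.mono_cost (reach_regular hω hℓ (c := 36) hK (ofCoeffs_mem x) (ofCoeffs_mem y)
    (mul_mem (ofCoeffs_mem x) (ofCoeffs_mem y)) (fun j K' hK' hf hg => ?_)
    (regSet_ofCoeffs x hK.zero hx _) (regSet_ofCoeffs y hK.zero hy _)) (by gcongr; norm_num)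
  rw [map_mul]
  exact reach_series_mul hω hK' hf hg

/-- `geomDiv` only specifies the result; the computation itself divides each point series by Newton
iteration. -/
theorem reach_div (hu : IsUnit (x (oneMonomial r (Nat.two_pow_pos ℓ)))) :
    Reach K (1000 * (2 ^ ℓ) ^ (r + 1) * (ℓ * (r + 1)))
      (regSet (geomDiv (2 ^ ℓ) (constY r (Ring.inverse (x (oneMonomial r (Nat.two_pow_pos ℓ)))))
        (ofCoeffs x) (ofCoeffs y)) (2 ^ ℓ)) := by
  refine Reach.mono_cost (reach_regular hω hℓ (c := 186) hK (ofCoeffs_mem x) (ofCoeffs_mem y)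
    (geomDiv_mem (constY_mem _) (ofCoeffs_mem x) (ofCoeffs_mem y) _) (fun j K' hK' hf hg => ?_)
    (regSet_ofCoeffs x hK.zero hx _) (regSet_ofCoeffs y hK.zero hy _)) (by gcongr; norm_num)
  have hc := constantCoeff_pointSeries_ofCoeffs (Nat.two_pow_pos ℓ) (ω (ℓ * r)) j x
  refine reach_series_div hω hK' (hc ▸ hu) ?_ hf hg
  rw [map_geomDiv, pointSeries_constY, geomDiv_mul_sub]
  refine (X_pow_dvd_pow ?_).mul_left _
  rw [map_sub, map_mul, hc, PowerSeries.constantCoeff_C, Ring.inverse_mul_cancel _ hu, map_one,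
    sub_self]

end Binary

theorem reach_exp (hn : ∀ i : ℕ, 0 < i → i < 2 ^ ℓ → IsUnit (i : A))
    (h0 : x (oneMonomial r (Nat.two_pow_pos ℓ)) = 0) :
    Reach K (1000 * (2 ^ ℓ) ^ (r + 1) * (ℓ * (r + 1)))
      (regSet (expSum (2 ^ ℓ) (ofCoeffs x)) (2 ^ ℓ)) := by
  -- The most expensive of the four operations: 17 + 2·460 = 937 ≤ 1000.
  refine Reach.mono_cost (reach_regular hω hℓ (c := 460) hK (ofCoeffs_mem x) (ofCoeffs_mem x)
    (expSum_mem hn (ofCoeffs_mem x)) (fun j K' hK' hf _ => ?_)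
    (regSet_ofCoeffs x hK.zero hx _) (regSet_ofCoeffs x hK.zero hx _)) (by gcongr; norm_num)
  have hc := constantCoeff_pointSeries_ofCoeffs (Nat.two_pow_pos ℓ) (ω (ℓ * r)) j x
  rw [h0] at hc
  rw [map_expSum _ (isUnit_natCast_map (constY r) hn)]
  exact reach_series_exp hω hK' hn hc (constantCoeff_expSum (Nat.two_pow_pos ℓ) hc)
    (derivative_expSum hn hc) hf

theorem reach_log (hn : ∀ i : ℕ, 0 < i → i < 2 ^ ℓ → IsUnit (i : A))
    (h1 : x (oneMonomial r (Nat.two_pow_pos ℓ)) = 1) :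
    Reach K (1000 * (2 ^ ℓ) ^ (r + 1) * (ℓ * (r + 1)))
      (regSet (logSum (2 ^ ℓ) (ofCoeffs x)) (2 ^ ℓ)) := by
  refine Reach.mono_cost (reach_regular hω hℓ (c := 190) hK (ofCoeffs_mem x) (ofCoeffs_mem x)
    (logSum_mem hn (ofCoeffs_mem x)) (fun j K' hK' hf _ => ?_)
    (regSet_ofCoeffs x hK.zero hx _) (regSet_ofCoeffs x hK.zero hx _)) (by gcongr; norm_num)
  have hc := constantCoeff_pointSeries_ofCoeffs (Nat.two_pow_pos ℓ) (ω (ℓ * r)) j x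
  rw [h1] at hc
  rw [map_logSum _ (isUnit_natCast_map (constY r) hn)]
  exact reach_series_log hω hK' hn hc (constantCoeff_logSum hc) (derivative_logSum hn hc) hf

end Operations

/-! ### Uniform programs -/

/-- From (ω^(2^j))² = 1 the factor ω^(2^j) - 1, not being a zero divisor, can be cancelled, which
leaves ω^(2^j) = -1. The case k = 1 makes 2 invertible. -/
theorem SupportsFFTVia.isFFTSeq {R : Type*} [CommRing R] {ω : ℕ → R} (h : SupportsFFTVia ω) :
    IsFFTSeq ω := by
  refine ⟨by simpa using (h 1).isUnit_natCast, fun k => ⟨(h k).pow_eq_one, ?_⟩⟩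
  rintro j rfl
  have h1 := (h (j + 1)).pow_eq_one
  have h2 := (h (j + 1)).sub_one_mem 2 Nat.prime_two (dvd_pow_self 2 j.succ_ne_zero)
  rw [pow_succ 2 j, Nat.mul_div_cancel _ two_pos] at h2
  rw [pow_succ 2 j, pow_mul] at h1
  have h3 : (ω (j + 1) ^ 2 ^ j + 1) * (ω (j + 1) ^ 2 ^ j - 1) = 0 := by linear_combination h1
  exact eq_neg_of_add_eq_zero_left ((mul_right_mem_nonZeroDivisors_eq_zero_iff h2).mp h3)

theorem ContainsRatOrZMod.isUnit_natCast {R : Type*} [CommRing R] {d : ℕ}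
    (h : ContainsRatOrZMod R d) (i : ℕ) (hi : 0 < i) (hid : i < d) : IsUnit (i : R) := by
  rcases h with ⟨φ, -⟩ | ⟨p, hp, hdp, φ, -⟩
  · have : IsUnit (i : ℚ) := isUnit_iff_ne_zero.mpr (Nat.cast_ne_zero.mpr hi.ne')
    simpa using this.map φ
  · have := Fact.mk hp
    have : IsUnit (i : ZMod p) := by
      rw [isUnit_iff_ne_zero, Ne, ZMod.natCast_eq_zero_iff]
      exact Nat.not_dvd_of_pos_of_lt hi (hid.trans hdp)
    simpa using this.map φ

/-! ### Transfer between the product ring and its factors. -/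

section Universal

variable {ι : Type} {Q : ∀ (R : Type u) [CommRing R], (ℕ → R) → (ι → R) → Prop}

/-- The roots of unity of the universal ring. -/
def universalRoot (ι : Type) (Q : ∀ (R : Type u) [CommRing R], (ℕ → R) → (ι → R) → Prop) (k : ℕ) :
    UniversalRing ι Q :=
  fun s => s.ω k

/-- The inputs in the universal ring. -/
def universalInput (Q : ∀ (R : Type u) [CommRing R], (ℕ → R) → (ι → R) → Prop) (i : ι) :
    UniversalRing ι Q :=
  fun s => s.x i

theorem isUnit_universal {a : UniversalRing ι Q} (h : ∀ s, IsUnit (a s)) : IsUnit a :=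
  Pi.isUnit_iff.mpr h

theorem isFFTSeq_universal (hQ : ∀ (R : Type u) [CommRing R] (ω : ℕ → R) (x : ι → R),
    Q R ω x → SupportsFFTVia ω) : IsFFTSeq (universalRoot ι Q) := by
  have h := fun s : ProgramInstance ι Q => (hQ s.R s.ω s.x s.cond).isFFTSeq
  exact ⟨isUnit_universal fun s => (h s).isUnit_two, fun k =>
    ⟨funext fun s => ((h s).root k).pow_eq_one,
      fun j hj => funext fun s => ((h s).root k).pow_eq_neg_one j hj⟩⟩

theorem isUnit_natCast_universal {d : ℕ} (hQ : ∀ (R : Type u) [CommRing R] (ω : ℕ → R) (x : ι → R),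
    Q R ω x → ContainsRatOrZMod R d) (i : ℕ) (hi : 0 < i) (hid : i < d) :
    IsUnit (i : UniversalRing ι Q) :=
  isUnit_universal fun s => (hQ s.R s.ω s.x s.cond).isUnit_natCast i hi hid

theorem hasConsts_initialSet {A : Type*} [CommRing A] (ω : ℕ → A) (x : ι → A) :
    HasConsts ω (initialSet ω x) := by
  refine ⟨?_, ?_, fun k => ?_⟩ <;> simp [initialSet]

theorem range_comp_subset_initialSet {κ A : Type*} [CommRing A] (ω : ℕ → A) (x : ι → A)
    (e : κ → ι) : Set.range (fun i => x (e i)) ⊆ initialSet ω x := by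
  rintro _ ⟨i, rfl⟩
  exact Or.inr ⟨e i, rfl⟩

/-- Projection to a factor specialises the universal series to that instance, so one computation
yields the correct outputs everywhere. -/
theorem exists_regular_program {r d c : ℕ} {f : YSeries (UniversalRing ι Q) r}
    (h : Reach (initialSet (universalRoot ι Q) (universalInput Q)) c (regSet f d)) :
    ∃ P : RingProgram ι (RegMonomial r d), P.cost ≤ c ∧ ∀ s : ProgramInstance ι Q,
      P.Outputs s.ω s.x (regCoeffs (Ideal.Quotient.mk _
        (mapY r (Pi.evalRingHom (fun s : ProgramInstance ι Q => s.R) s) f) : YTrunc s.R r d)) := by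
  obtain ⟨P, hc, hP⟩ := exists_program (regCoeff (d := d) f)
    (h.bind (c' := 0) fun K' _ h' => .done ((range_regCoeff_subset f).trans h'))
  refine ⟨P, hc, fun s => ?_⟩
  convert hP s using 1
  funext m
  rw [regCoeffs_mk, regCoeff_mapY, Pi.evalRingHom_apply]

end Universal

/-! ### The four programs and their cost. -/

section Programs

variable {r d ℓ : ℕ} (hℓ : 1 ≤ ℓ) (hd : d = 2 ^ ℓ)

include hℓ hd

theorem exists_mul_program :
    ∃ P : RingProgram (RegMonomial r d ⊕ RegMonomial r d) (RegMonomial r d),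
      P.cost ≤ 1000 * d ^ (r + 1) * (ℓ * (r + 1)) ∧
      ∀ (R : Type u) [CommRing R] (ω : ℕ → R), SupportsFFTVia ω →
        ∀ F ∈ regularTrunc R r d, ∀ G ∈ regularTrunc R r d,
          P.Outputs ω (Sum.elim (regCoeffs F) (regCoeffs G)) (regCoeffs (F * G)) := by
  subst hd
  let Q : ∀ (R : Type u) [CommRing R], (ℕ → R) →
    (RegMonomial r (2 ^ ℓ) ⊕ RegMonomial r (2 ^ ℓ) → R) → Prop := fun R _ ω _ => SupportsFFTVia ω
  obtain ⟨P, hP, h⟩ := exists_regular_program (reach_mul (isFFTSeq_universal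
    (Q := Q) fun R _ ω x h => h) hℓ (hasConsts_initialSet _ _)
    (range_comp_subset_initialSet _ (universalInput Q) Sum.inl)
    (range_comp_subset_initialSet _ (universalInput Q) Sum.inr))
  refine ⟨P, hP, fun R _ ω hω F hF G hG => ?_⟩
  have := h ⟨R, ω, Sum.elim (regCoeffs F) (regCoeffs G), hω⟩
  rw [map_mul, mapY_ofCoeffs, mapY_ofCoeffs, map_mul] at this
  convert this
  · exact (mk_ofCoeffs_regCoeffs hF).symm
  · exact (mk_ofCoeffs_regCoeffs hG).symm

/-- Invertibility of the constant term is part of the condition on instances, which makes the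
universal constant term a unit of the product ring. -/
theorem exists_div_program (hd0 : 0 < d) :
    ∃ P : RingProgram (RegMonomial r d ⊕ RegMonomial r d) (RegMonomial r d),
      P.cost ≤ 1000 * d ^ (r + 1) * (ℓ * (r + 1)) ∧
      ∀ (R : Type u) [CommRing R] (ω : ℕ → R), SupportsFFTVia ω →
        ∀ F ∈ regularTrunc R r d, ∀ G ∈ regularTrunc R r d, IsUnit (sCoeff ⟨0, hd0⟩ F) →
          ∃ H ∈ regularTrunc R r d, H * F = G ∧
            P.Outputs ω (Sum.elim (regCoeffs F) (regCoeffs G)) (regCoeffs H) := by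
  subst hd
  let Q : ∀ (R : Type u) [CommRing R], (ℕ → R) →
    (RegMonomial r (2 ^ ℓ) ⊕ RegMonomial r (2 ^ ℓ) → R) → Prop := fun R _ ω x =>
      SupportsFFTVia ω ∧ IsUnit (x (.inl (oneMonomial r hd0)))
  have hu : IsUnit (universalInput Q (.inl (oneMonomial r hd0))) :=
    isUnit_universal fun s => s.cond.2
  obtain ⟨P, hP, h⟩ := exists_regular_program (reach_div (isFFTSeq_universal
    (Q := Q) fun R _ ω x h => h.1) hℓ (hasConsts_initialSet _ _)
    (range_comp_subset_initialSet _ (universalInput Q) Sum.inl)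
    (range_comp_subset_initialSet _ (universalInput Q) Sum.inr) hu)
  refine ⟨P, hP, fun R _ ω hω F hF G hG hF0 => ?_⟩
  rw [sCoeff_zero_of_mem hd0 hF] at hF0
  -- The constant term is a unit of the polynomial ring; as it is a scalar, taking its constant
  -- coefficient gives a unit of R.
  replace hF0 : IsUnit (regCoeffs F (oneMonomial r hd0)) := by
    simpa using hF0.map MvPolynomial.constantCoeff
  have := h ⟨R, ω, Sum.elim (regCoeffs F) (regCoeffs G), hω, hF0⟩
  rw [map_geomDiv, mapY_constY, mapY_ofCoeffs, mapY_ofCoeffs, map_ring_inverse _ hu] at this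
  set f : YSeries R r := ofCoeffs (regCoeffs F) with hf
  set g : YSeries R r := ofCoeffs (regCoeffs G) with hg
  set c : YSeries R r := constY r (Ring.inverse (regCoeffs F (oneMonomial r hd0))) with hc
  refine ⟨Ideal.Quotient.mk _ (geomDiv (2 ^ ℓ) c f g), ⟨_, geomDiv_mem (constY_mem _)
    (ofCoeffs_mem _) (ofCoeffs_mem _) _, rfl⟩, ?_, this⟩
  have hFG : (Ideal.Quotient.mk _ (geomDiv (2 ^ ℓ) c f g * f) : YTrunc R r (2 ^ ℓ)) =
      Ideal.Quotient.mk _ g := by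
    refine mk_eq_mk ?_
    rw [geomDiv_mul_sub]
    refine (X_pow_dvd_pow ?_).mul_left _
    rw [map_sub, map_mul, hf, coeff_zero_ofCoeffs hd0, map_one, hc, constY, RingHom.comp_apply,
      PowerSeries.constantCoeff_C, ← map_mul, Ring.inverse_mul_cancel _ hF0, map_one, sub_self]
  rwa [map_mul, hf, mk_ofCoeffs_regCoeffs hF, hg, mk_ofCoeffs_regCoeffs hG] at hFG

theorem exists_exp_program (hd0 : 0 < d) :
    ∃ P : RingProgram (RegMonomial r d) (RegMonomial r d),
      P.cost ≤ 1000 * d ^ (r + 1) * (ℓ * (r + 1)) ∧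
      ∀ (R : Type u) [CommRing R] (ω : ℕ → R), ContainsRatOrZMod R d → SupportsFFTVia ω →
        ∀ F ∈ regularTrunc R r d, sCoeff ⟨0, hd0⟩ F = 0 →
          truncExp F ∈ regularTrunc R r d ∧
            P.Outputs ω (regCoeffs F) (regCoeffs (truncExp F)) := by
  subst hd
  let Q : ∀ (R : Type u) [CommRing R], (ℕ → R) → (RegMonomial r (2 ^ ℓ) → R) → Prop :=
    fun R _ ω x => ContainsRatOrZMod R (2 ^ ℓ) ∧ SupportsFFTVia ω ∧ x (oneMonomial r hd0) = 0
  have hn := isUnit_natCast_universal (Q := Q) (d := 2 ^ ℓ) fun R _ ω x h => h.1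
  obtain ⟨P, hP, h⟩ := exists_regular_program (reach_exp (isFFTSeq_universal
    (Q := Q) fun R _ ω x h => h.2.1) hℓ (hasConsts_initialSet _ _)
    (range_comp_subset_initialSet _ (universalInput Q) id) hn (funext fun s => s.cond.2.2))
  refine ⟨P, hP, fun R _ ω hR hω F hF hF0 => ?_⟩
  rw [sCoeff_zero_of_mem hd0 hF, MvPolynomial.C_eq_zero] at hF0
  have hnR := hR.isUnit_natCast
  have hF' : truncExp F = Ideal.Quotient.mk _ (expSum (2 ^ ℓ) (ofCoeffs (regCoeffs F))) := by
    rw [map_expSum _ (isUnit_natCast_map (constY r) hnR), mk_ofCoeffs_regCoeffs hF]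
    rfl
  have := h ⟨R, ω, regCoeffs F, hR, hω, hF0⟩
  rw [map_expSum _ (isUnit_natCast_map (constY r) hn), mapY_ofCoeffs] at this
  rw [hF']
  exact ⟨⟨_, expSum_mem hnR (ofCoeffs_mem _), rfl⟩, this⟩

theorem exists_log_program (hd0 : 0 < d) :
    ∃ P : RingProgram (RegMonomial r d) (RegMonomial r d),
      P.cost ≤ 1000 * d ^ (r + 1) * (ℓ * (r + 1)) ∧
      ∀ (R : Type u) [CommRing R] (ω : ℕ → R), ContainsRatOrZMod R d → SupportsFFTVia ω →
        ∀ F ∈ regularTrunc R r d, sCoeff ⟨0, hd0⟩ F = 1 →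
          truncLog F ∈ regularTrunc R r d ∧
            P.Outputs ω (regCoeffs F) (regCoeffs (truncLog F)) := by
  subst hd
  let Q : ∀ (R : Type u) [CommRing R], (ℕ → R) → (RegMonomial r (2 ^ ℓ) → R) → Prop :=
    fun R _ ω x => ContainsRatOrZMod R (2 ^ ℓ) ∧ SupportsFFTVia ω ∧ x (oneMonomial r hd0) = 1
  have hn := isUnit_natCast_universal (Q := Q) (d := 2 ^ ℓ) fun R _ ω x h => h.1
  obtain ⟨P, hP, h⟩ := exists_regular_program (reach_log (isFFTSeq_universal
    (Q := Q) fun R _ ω x h => h.2.1) hℓ (hasConsts_initialSet _ _)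
    (range_comp_subset_initialSet _ (universalInput Q) id) hn (funext fun s => s.cond.2.2))
  refine ⟨P, hP, fun R _ ω hR hω F hF hF1 => ?_⟩
  rw [sCoeff_zero_of_mem hd0 hF, ← MvPolynomial.C_1,
    (MvPolynomial.C_injective _ _).eq_iff] at hF1
  have hnR := hR.isUnit_natCast
  have hF' : truncLog F = Ideal.Quotient.mk _ (logSum (2 ^ ℓ) (ofCoeffs (regCoeffs F))) := by
    rw [map_logSum _ (isUnit_natCast_map (constY r) hnR), mk_ofCoeffs_regCoeffs hF]
    rfl
  have := h ⟨R, ω, regCoeffs F, hR, hω, hF1⟩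
  rw [map_logSum _ (isUnit_natCast_map (constY r) hn), mapY_ofCoeffs] at this
  rw [hF']
  exact ⟨⟨_, logSum_mem hnR (ofCoeffs_mem _), rfl⟩, this⟩

omit hℓ in
-- As log 2 ≥ 1/2, the binary logarithm ℓ(r+1) of d^(r+1) is at most twice the natural one, which
-- doubles the constant.
theorem cost_bound {c : ℕ} (h : c ≤ 1000 * d ^ (r + 1) * (ℓ * (r + 1))) :
    (c : ℝ) ≤ 2000 * ((d : ℝ) ^ (r + 1) * Real.log ((d : ℝ) ^ (r + 1))) := by
  have h' : (c : ℝ) ≤ 1000 * (d : ℝ) ^ (r + 1) * (ℓ * (r + 1)) := by exact_mod_cast h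
  have hlog : Real.log ((d : ℝ) ^ (r + 1)) = (ℓ * (r + 1)) * Real.log 2 := by
    rw [Real.log_pow, hd, Nat.cast_pow, Nat.cast_ofNat, Real.log_pow]
    push_cast
    ring
  have h2 : (1 : ℝ) / 2 ≤ Real.log 2 := by linarith [Real.log_two_gt_d9]
  rw [hlog]
  refine h'.trans ?_
  have hnonneg : (0 : ℝ) ≤ (d : ℝ) ^ (r + 1) * (ℓ * (r + 1)) := by positivity
  nlinarith

end Programs

theorem mainTheorem5 :
    ∃ C : ℝ, ∀ r ℓ d : ℕ, 1 ≤ ℓ → ∀ hd : d = 2 ^ ℓ,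
      ∃ (Pmul Pdiv : RingProgram (RegMonomial r d ⊕ RegMonomial r d) (RegMonomial r d))
        (Pexp Plog : RingProgram (RegMonomial r d) (RegMonomial r d)),
        -- every program uses `O(d ^ (r + 1) * log (d ^ (r + 1)))` ring operations
        (Pmul.cost : ℝ) ≤ C * ((d : ℝ) ^ (r + 1) * Real.log ((d : ℝ) ^ (r + 1))) ∧
        (Pdiv.cost : ℝ) ≤ C * ((d : ℝ) ^ (r + 1) * Real.log ((d : ℝ) ^ (r + 1))) ∧
        (Pexp.cost : ℝ) ≤ C * ((d : ℝ) ^ (r + 1) * Real.log ((d : ℝ) ^ (r + 1))) ∧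
        (Plog.cost : ℝ) ≤ C * ((d : ℝ) ^ (r + 1) * Real.log ((d : ℝ) ^ (r + 1))) ∧
        ∀ (R : Type u) [CommRing R] (ω : ℕ → R), ContainsRatOrZMod R d → SupportsFFTVia ω →
          -- multiplication
          (∀ F ∈ regularTrunc R r d, ∀ G ∈ regularTrunc R r d,
            F * G ∈ regularTrunc R r d ∧
            Pmul.Outputs ω (Sum.elim (regCoeffs F) (regCoeffs G)) (regCoeffs (F * G))) ∧
          -- division `G / F`, for `F` whose constant term in `s` is invertible
          (∀ F ∈ regularTrunc R r d, ∀ G ∈ regularTrunc R r d,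
            IsUnit (sCoeff ⟨0, hd ▸ Nat.two_pow_pos ℓ⟩ F) →
            ∃ H ∈ regularTrunc R r d, H * F = G ∧
              Pdiv.Outputs ω (Sum.elim (regCoeffs F) (regCoeffs G)) (regCoeffs H)) ∧
          -- exponential, for `F` with constant term `0` in `s`
          (∀ F ∈ regularTrunc R r d, sCoeff ⟨0, hd ▸ Nat.two_pow_pos ℓ⟩ F = 0 →
            truncExp F ∈ regularTrunc R r d ∧
            Pexp.Outputs ω (regCoeffs F) (regCoeffs (truncExp F))) ∧
          -- logarithm, for `F` with constant term `1` in `s`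
          (∀ F ∈ regularTrunc R r d, sCoeff ⟨0, hd ▸ Nat.two_pow_pos ℓ⟩ F = 1 →
            truncLog F ∈ regularTrunc R r d ∧
            Plog.Outputs ω (regCoeffs F) (regCoeffs (truncLog F))) := by
  refine ⟨2000, fun r ℓ d hℓ hd => ?_⟩
  have hd0 : 0 < d := hd ▸ Nat.two_pow_pos ℓ
  obtain ⟨Pmul, cmul, hmul⟩ := exists_mul_program (r := r) hℓ hd
  obtain ⟨Pdiv, cdiv, hdiv⟩ := exists_div_program (r := r) hℓ hd hd0
  obtain ⟨Pexp, cexp, hexp⟩ := exists_exp_program (r := r) hℓ hd hd0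
  obtain ⟨Plog, clog, hlog⟩ := exists_log_program (r := r) hℓ hd hd0
  exact ⟨Pmul, Pdiv, Pexp, Plog, cost_bound hd cmul, cost_bound hd cdiv, cost_bound hd cexp,
    cost_bound hd clog, fun R _ ω hR hω =>
      ⟨fun F hF G hG => ⟨mul_mem hF hG, hmul R ω hω F hF G hG⟩, hdiv R ω hω,
        hexp R ω hR hω, hlog R ω hR hω⟩⟩
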